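/- Let $n\ge 1$, let $\beta,\varepsilon\in\mathbb C^n$, $\phi,\zeta\in\mathbb C$ and let ${\bf X}_0$ be a constant symmetric $n\times n$ matrix (real constants are a special case). Put ${\bf X}=-2Z\,{\bf 1}_n+{\bf X}_0$ and $$ {\bf N}=\begin{pmatrix} Y&\beta^T&Z\\ \beta&{\bf X}&\varepsilon\\ Z&\varepsilon^T&\phi\end{pmatrix},\qquad \det{\bf N}=Y\,D(Z)+E(Z), $$ where $D,E$ are polynomials in $Z$. The quadric ansatz reduction of the $mn$-dKP equation $u_{xt}-(u^mu_x)_x=\sum_i u_{y_iy_i}$ is the system $Y'+2u^mZ'=0$, $\det{\bf N}=4\zeta(Z')^2$ for functions $Y(u),Z(u)$, $\zeta\neq0$ constant; eliminating $Y$ gives the reduced ODE $$ Z''=A(Z)(Z')^2+B(Z)+C(Z)u^m,\qquad A=\frac{D'}{2D},\quad B=\frac1{8\zeta}\Big(E'-\frac{E\,D'}{D}\Big),\quad C=-\frac{D}{4\zeta}. \tag{$*$} $$ Consider $(*)$ over $\mathbb C$; its solutions on an open set are the holomorphic $Z$ with $D(Z)\ne0$ there that satisfy $(*)$. As $(*)$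 has no fixed singularities, it has the Painlevé property if and only if every solution on a domain of $\mathbb C$ is the restriction of a meromorphic function on $\mathbb C$ (the only movable singularities that solutions develop are poles). **Proposition.** Let $m=1$, $\phi\ne0$ and $\zeta\neq0$. 1. If $n=1$, then $(*)$ is equivalent to Painlevé II: there are constants $\alpha,z_0,l,\mu,\nu\in\mathbb C$, $l,\mu\ne0$, such that, with $s=\mu u+\nu$ and $Z=z_0+l\,p$, the maps $$ p=\frac{dq}{ds}+q^2+\frac s2,\qquad q=\frac{1}{2p}\Big(\frac{dp}{ds}-\alpha-\frac12\Big) $$ are, on every open set, mutually inverse bijections between the solutions $Z$ of $(*)$ and the holomorphic solutions $q$ of $\frac{d^2q}{ds^2}=2q^3+sq+\alpha$ for which $\frac{dq}{ds}+q^2+\frac s2$ has no zeros. 2. If $n>1$, then $(*)$ does not have the Painlevé property. More precisely: (a) If $n>2$, there are movable algebraic branch points with exponent $-2/n$: for all $u_0\in\mathbb C$ and all $a$ with $(-2)^n n^2a^n=-16\zeta$ there is $b\in\mathbb C$ such that for every $c\in\mathbb C$ there is a function $H$, holomorphic near $0$, with $H(t)=a+bt^2+ct^4+O(t^5)$, for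 which $$ Z(u)=(u-u_0)^{-2/n}\,H\big((u-u_0)^{1/n}\big) $$ is a solution of $(*)$ for $u\ne u_0$ near $u_0$, for every holomorphic branch of $(u-u_0)^{1/n}$. (b) If $n=2$, there are movable logarithmic branch points: for all $u_0,c\in\mathbb C$, all $\kappa$ with $\kappa^2=-\zeta$ and all $M>0$ there is $r>0$ and a holomorphic function $F$ on $\{x\in\mathbb C: e^{\operatorname{Re}x}<r,\ |\operatorname{Im}x|<M\}$ such that $Z(u)=F(\ln(u-u_0))$ is a solution of $(*)$ for every holomorphic branch of $\ln(u-u_0)$ with values in this half-strip, and $$ Z(u)=\frac{\kappa}{u-u_0}+\frac{\operatorname{tr}{\bf X}_0}{8}-\frac{\phi u_0}{2}+\Big(c+\frac{\phi}{3}\ln(u-u_0)\Big)(u-u_0)+o(u-u_0), $$ that is, $F(x)=\kappa e^{-x}+\frac{\operatorname{tr}{\bf X}_0}{8}-\frac{\phi u_0}{2}+\big(c+\frac{\phi}{3}x\big)e^{x}+o(e^{x})$ as $\operatorname{Re}x\to-\infty$ in the half-strip. -/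

import Mathlib

open Set Filter Topology Asymptotics

noncomputable section

/-- The constants of the quadric ansatz: `β`, `ε`, `φ` and the constant symmetric matrix `X₀`
(with diagonal entries `γ_i` and off-diagonal entries `α_{ij}`). -/
structure QuadricConstants (n : ℕ) where
  β : Fin n → ℂ
  ε : Fin n → ℂ
  φ : ℂ
  X₀ : Matrix (Fin n) (Fin n) ℂ
  symm : X₀.IsSymm

namespace QuadricConstants

variable {n : ℕ} (K : QuadricConstants n)

/-- `X = -2 Z 1_n + X₀`. -/
def matrixX (Z : ℂ) : Matrix (Fin n) (Fin n) ℂ :=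
  (-2 * Z) • (1 : Matrix (Fin n) (Fin n) ℂ) + K.X₀

/-- The lower right block of `N`: the matrix `X` bordered by `ε`, with corner `φ`. -/
def lowerBlock (Z : ℂ) : Matrix (Fin n ⊕ Unit) (Fin n ⊕ Unit) ℂ :=
  Matrix.fromBlocks (K.matrixX Z) (Matrix.of fun i _ => K.ε i) (Matrix.of fun _ j => K.ε j)
    (Matrix.of fun _ _ => K.φ)

/-- The symmetric `(n+2) × (n+2)` matrix `N`, with rows `(Y, β, Z)`, `(βᵀ, X, εᵀ)`, `(Z, ε, φ)`. -/
def matrixN (Y Z : ℂ) : Matrix (Unit ⊕ (Fin n ⊕ Unit)) (Unit ⊕ (Fin n ⊕ Unit)) ℂ :=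
  Matrix.fromBlocks (Matrix.of fun _ _ => Y)
    (Matrix.of fun _ j => Sum.elim K.β (fun _ => Z) j)
    (Matrix.of fun i _ => Sum.elim K.β (fun _ => Z) i)
    (K.lowerBlock Z)

/-- The coefficient `D(Z)` of `Y` in `det N = Y D(Z) + E(Z)`. -/
def D (Z : ℂ) : ℂ := (K.lowerBlock Z).det

/-- The part `E(Z)` of `det N = Y D(Z) + E(Z)` that does not involve `Y`. -/
def E (Z : ℂ) : ℂ := (K.matrixN 0 Z).det

theorem det_matrixN (Y Z : ℂ) : (K.matrixN Y Z).det = Y * K.D Z + K.E Z := by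
  have h0 : K.matrixN Y Z = (K.matrixN 0 Z).updateRow (Sum.inl ())
      (Pi.single (Sum.inl ()) Y + K.matrixN 0 Z (Sum.inl ())) := by
    ext i j
    rcases i with i | i <;> rcases j with j | j <;>
      simp [matrixN, Matrix.updateRow_apply]
  have h1 : (K.matrixN 0 Z).updateRow (Sum.inl ()) (Pi.single (Sum.inl ()) Y) =
      Matrix.fromBlocks (Matrix.of fun (_ _ : Unit) => Y) 0
        (Matrix.of fun i (_ : Unit) => Sum.elim K.β (fun _ => Z) i) (K.lowerBlock Z) := by
    ext i j
    rcases i with i | i <;> rcases j with j | j <;>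
      simp [matrixN, Matrix.updateRow_apply]
  rw [h0, Matrix.det_updateRow_add, h1, Matrix.det_fromBlocks_zero₁₂, Matrix.updateRow_eq_self]
  simp [D, E]

/-- The rational functions `A`, `B`, `C` of `Z'' = A(Z) (Z')² + B(Z) + C(Z) u^m`. -/
def A (Z : ℂ) : ℂ := deriv K.D Z / (2 * K.D Z)

def B (ζ Z : ℂ) : ℂ := (deriv K.E Z - K.E Z * deriv K.D Z / K.D Z) / (8 * ζ)

def C (ζ Z : ℂ) : ℂ := -K.D Z / (4 * ζ)

/-- `Z` is a holomorphic solution on the open set `U ⊆ ℂ` of the reduced equation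
`Z'' = A(Z) (Z')² + B(Z) + C(Z) u^m`; the values of `Z` avoid the poles of `A` and `B`. -/
def IsReducedSolution (ζ : ℂ) (m : ℕ) (U : Set ℂ) (Z : ℂ → ℂ) : Prop :=
  DifferentiableOn ℂ Z U ∧ ∀ u ∈ U, K.D (Z u) ≠ 0 ∧
    deriv (deriv Z) u = K.A (Z u) * deriv Z u ^ 2 + K.B ζ (Z u) + K.C ζ (Z u) * u ^ m

theorem differentiable_D : Differentiable ℂ K.D := by
  unfold D
  simp only [Matrix.det_apply]
  refine Differentiable.fun_sum fun σ _ => Differentiable.const_smul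
    (Differentiable.fun_finsetProd fun i _ => ?_) _
  rcases h : σ i with j | j <;> rcases i with i | i <;>
    simp only [lowerBlock, matrixX, Matrix.fromBlocks_apply₁₁, Matrix.fromBlocks_apply₁₂,
      Matrix.fromBlocks_apply₂₁, Matrix.fromBlocks_apply₂₂, Matrix.of_apply, Matrix.add_apply,
      Matrix.smul_apply, smul_eq_mul] <;> fun_prop

theorem differentiable_E : Differentiable ℂ K.E := by
  unfold E
  simp only [Matrix.det_apply]
  refine Differentiable.fun_sum fun σ _ => Differentiable.const_smul
    (Differentiable.fun_finsetProd fun i _ => ?_) _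
  rcases h : σ i with j | j | j <;> rcases i with i | i | i <;>
    simp only [matrixN, lowerBlock, matrixX, Matrix.fromBlocks_apply₁₁,
      Matrix.fromBlocks_apply₁₂, Matrix.fromBlocks_apply₂₁, Matrix.fromBlocks_apply₂₂,
      Matrix.of_apply, Matrix.add_apply, Matrix.smul_apply, smul_eq_mul, Sum.elim_inl,
      Sum.elim_inr] <;> fun_prop

/-- The reduced equation is what remains of the system `Y' + 2 u^m Z' = 0`,
`det N = 4 ζ (Z')²` after the elimination of `Y`. -/
theorem isReducedSolution_iff {ζ : ℂ} (hζ : ζ ≠ 0) (m : ℕ) {U : Set ℂ} (hU : IsOpen U)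
    {Z : ℂ → ℂ} (hZ : DifferentiableOn ℂ Z U) (hD : ∀ u ∈ U, K.D (Z u) ≠ 0)
    (hZ' : ∀ u ∈ U, deriv Z u ≠ 0) :
    K.IsReducedSolution ζ m U Z ↔
      ∃ Y : ℂ → ℂ, ∀ u ∈ U, HasDerivAt Y (-2 * u ^ m * deriv Z u) u ∧
        (K.matrixN (Y u) (Z u)).det = 4 * ζ * deriv Z u ^ 2 := by
  set Y₀ : ℂ → ℂ := fun u => (4 * ζ * deriv Z u ^ 2 - K.E (Z u)) / K.D (Z u) with hY₀
  have key : ∀ u ∈ U, HasDerivAt Y₀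
      (8 * ζ * deriv Z u / K.D (Z u) * (deriv (deriv Z) u -
        (K.A (Z u) * deriv Z u ^ 2 + K.B ζ (Z u) + K.C ζ (Z u) * u ^ m))
        + -2 * u ^ m * deriv Z u) u := by
    intro u hu
    have hz : HasDerivAt Z (deriv Z u) u := (hZ.differentiableAt (hU.mem_nhds hu)).hasDerivAt
    have hz2 : HasDerivAt (deriv Z) (deriv (deriv Z) u) u :=
      ((hZ.deriv hU).differentiableAt (hU.mem_nhds hu)).hasDerivAt
    have hd : HasDerivAt (fun v => K.D (Z v)) (deriv K.D (Z u) * deriv Z u) u :=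
      (K.differentiable_D (Z u)).hasDerivAt.comp u hz
    have he : HasDerivAt (fun v => K.E (Z v)) (deriv K.E (Z u) * deriv Z u) u :=
      (K.differentiable_E (Z u)).hasDerivAt.comp u hz
    have hDu := hD u hu
    refine ((((hz2.pow 2).const_mul (4 * ζ)).sub he).div hd hDu).congr_deriv ?_
    simp only [A, B, C, Pi.sub_apply, Pi.pow_apply]
    field_simp
    ring
  have hdet : ∀ u ∈ U, ∀ y : ℂ,
      (K.matrixN y (Z u)).det = 4 * ζ * deriv Z u ^ 2 ↔ y = Y₀ u := by
    intro u hu y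
    rw [K.det_matrixN, hY₀, eq_div_iff (hD u hu), eq_sub_iff_add_eq]
  constructor
  · rintro ⟨-, h⟩
    refine ⟨Y₀, fun u hu => ⟨?_, (hdet u hu _).2 rfl⟩⟩
    have := key u hu
    rwa [(h u hu).2, sub_self, mul_zero, zero_add] at this
  · rintro ⟨Y, hY⟩
    refine ⟨hZ, fun u hu => ⟨hD u hu, ?_⟩⟩
    have hev : Y =ᶠ[𝓝 u] Y₀ := by
      filter_upwards [hU.mem_nhds hu] with v hv
      exact (hdet v hv _).1 (hY v hv).2
    have h1 := (key u hu).unique ((hY u hu).1.congr_of_eventuallyEq hev.symm)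
    have h2 : 8 * ζ * deriv Z u / K.D (Z u) ≠ 0 :=
      div_ne_zero (mul_ne_zero (mul_ne_zero (by norm_num) hζ) (hZ' u hu)) (hD u hu)
    have h3 := (mul_eq_zero.1 (add_eq_right.1 h1)).resolve_left h2
    exact sub_eq_zero.1 h3

end QuadricConstants

/-- `q` is a holomorphic solution on `V` of Painlevé II, `q'' = 2 q³ + s q + α`. -/
def IsPainleveIISolution (α : ℂ) (V : Set ℂ) (q : ℂ → ℂ) : Prop :=
  DifferentiableOn ℂ q V ∧ ∀ s ∈ V, deriv (deriv q) s = 2 * q s ^ 3 + s * q s + α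

/-- The function `q' + q² + s / 2`. -/
def miura (q : ℂ → ℂ) (s : ℂ) : ℂ := deriv q s + q s ^ 2 + s / 2

/-- `Z(u) = z₀ + l (q'(s) + q(s)² + s / 2)` with `s = μ u + ν`. -/
def ofPainleveII (z₀ l μ ν : ℂ) (q : ℂ → ℂ) (u : ℂ) : ℂ := z₀ + l * miura q (μ * u + ν)

/-- The function `p(s) = (Z(u) - z₀) / l` with `s = μ u + ν`. -/
def rescale (z₀ l μ ν : ℂ) (Z : ℂ → ℂ) (s : ℂ) : ℂ := (Z ((s - ν) / μ) - z₀) / l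

/-- `q = (p' - α - 1/2) / (2 p)`, where `p(s) = (Z(u) - z₀) / l` and `s = μ u + ν`. -/
def toPainleveII (α z₀ l μ ν : ℂ) (Z : ℂ → ℂ) (s : ℂ) : ℂ :=
  (deriv (rescale z₀ l μ ν Z) s - α - 1 / 2) / (2 * rescale z₀ l μ ν Z s)

/-- The second order ODE with solution predicate `Sol` (`Sol U Z`: `Z` is a solution on the open
set `U`) is equivalent to a Painlevé II equation: for some parameter `α` and some affine changes
of the dependent and independent variables (`l, μ ≠ 0`), `toPainleveII` and `ofPainleveII` are
mutually inverse bijections, on every open set, between the solutions of the ODE and the solutions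
`q` of Painlevé II for which `q' + q² + s / 2` has no zeros. -/
def IsEquivalentToPainleveII (Sol : Set ℂ → (ℂ → ℂ) → Prop) : Prop :=
  ∃ α z₀ l μ ν : ℂ, l ≠ 0 ∧ μ ≠ 0 ∧ ∀ U : Set ℂ, IsOpen U →
    (∀ Z : ℂ → ℂ, Sol U Z →
      IsPainleveIISolution α ((fun s => (s - ν) / μ) ⁻¹' U) (toPainleveII α z₀ l μ ν Z) ∧
      (∀ s ∈ (fun s => (s - ν) / μ) ⁻¹' U, miura (toPainleveII α z₀ l μ ν Z) s ≠ 0) ∧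
      EqOn (ofPainleveII z₀ l μ ν (toPainleveII α z₀ l μ ν Z)) Z U) ∧
    (∀ q : ℂ → ℂ, IsPainleveIISolution α ((fun s => (s - ν) / μ) ⁻¹' U) q →
      (∀ s ∈ (fun s => (s - ν) / μ) ⁻¹' U, miura q s ≠ 0) →
      Sol U (ofPainleveII z₀ l μ ν q) ∧
      EqOn (toPainleveII α z₀ l μ ν (ofPainleveII z₀ l μ ν q)) q
        ((fun s => (s - ν) / μ) ⁻¹' U))

/-- The Painlevé property of an ODE without fixed singularities (so that every singularity of a
solution in the finite plane is movable): the only singularities that solutions develop are poles,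
that is, every solution on a domain is the restriction of a meromorphic function on `ℂ`. -/
def HasPainleveProperty (Sol : Set ℂ → (ℂ → ℂ) → Prop) : Prop :=
  ∀ (U : Set ℂ) (Z : ℂ → ℂ), IsOpen U → IsConnected U → Sol U Z →
    ∃ W : ℂ → ℂ, Meromorphic W ∧ EqOn Z W U

/-- `F`, a function on the region `Ω` of the plane of `x = log (u - u₀)`, is a (possibly
multivalued) solution around `u₀`: for every holomorphic branch `L` of `log (u - u₀)` on an open
set `V`, with values in `Ω`, the function `F ∘ L` is a solution on `V`. -/
def IsMultivaluedSolution (Sol : Set ℂ → (ℂ → ℂ) → Prop) (u₀ : ℂ) (Ω : Set ℂ) (F : ℂ → ℂ) :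
    Prop :=
  ∀ (V : Set ℂ) (L : ℂ → ℂ), IsOpen V → DifferentiableOn ℂ L V →
    (∀ u ∈ V, L u ∈ Ω ∧ Complex.exp (L u) = u - u₀) → Sol V (fun u => F (L u))

/-- The half strip `|exp x| < r`, `|Im x| < M`. -/
def logStrip (r M : ℝ) : Set ℂ := {x | ‖Complex.exp x‖ < r ∧ |x.im| < M}

end

/-!
**`n = 1`.** Here `D` is an affine function of `Z`, and in the variable `Z - z₀`, where `z₀` is its
zero, the reduced equation is Painlevé XXXIV up to scaling
(`QuadricConstants.exists_affine_change`). Painlevé XXXIV is equivalent to Painlevé II by the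
classical Bäcklund transformation `p = q' + q² + s / 2`, `p' = 2 q p + α + 1 / 2`.

**`n ≥ 2`.** The singular solutions are constructed in the variable `x = log (u - u₀)`, near
`Re x = -∞`. By `QuadricConstants.isReducedSolution_iff` it suffices to solve the first order system
`Y' + 2 u Z' = 0`, `det N = 4 ζ (Z')²`. With `τ = exp (x / n)`, `p = τ² / a`, `Z = m / p` and
`J = Y + 2 u Z` this system becomes
`m' = (2 / n) (m - √S)`, `J' = 2 a τ ^ (n - 2) m`,
where `S = scaledRHS` is regular near the end `Re x = -∞` and tends to `m ^ (n + 2)` there. The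
linearization at `m = 1` has the characteristic exponents `-1` (for `m`) and `0` (for `J`), so that
the only constant of integration is that of `J`; it enters `m` in order `τ⁴`, through the
coefficient `D(Z) ~ φ (-2 Z) ^ n` of `Y`, which is where `φ ≠ 0` is used. For `n > 2` the function
`J` is a power series in `τ`, and so is `m`. For `n = 2` it contains the term `2 a x`, which is the
source of the logarithm.

Existence is a fixed point argument: a two-term ansatz solves the system up to `O(τ⁵)`
(`scaledRHS_ansatz_isBigO`), and the correction is found by Picard iteration from `-∞`
(`exists_solution_of_lipschitz`, `exists_scaled_solution`). The iteration takes place among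
holomorphic functions on a region that is invariant under translations to the left, a half plane
for `n > 2` and a half strip for `n = 2`. In the first case the solution has the period `2 π i n`
and is therefore a holomorphic function of `τ` with a removable singularity at `τ = 0`.

The failure of the Painlevé property follows: the constructed solutions do not agree with a
meromorphic function near `u₀`, because their leading exponent `-2 / n` is not an integer
(`n > 2`), or because they contain a logarithm with the coefficient `φ / 3 ≠ 0` (`n = 2`).
-/

/-! ### Asymptotic integration from the left end of a region -/

section AsymptoticIntegration

open MeasureTheory

/-- A region of the plane that is invariant under the translations to the left. -/
def LeftInvariant (Ω : Set ℂ) : Prop := ∀ x ∈ Ω, ∀ s : ℝ, s ≤ 0 → x + s ∈ Ω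

theorem continuousOn_comp_add_ofReal {X : Type*} [TopologicalSpace X] {Ω : Set ℂ}
    (hΩ : LeftInvariant Ω) {F : ℂ → X} (hF : ContinuousOn F Ω) {x : ℂ} (hx : x ∈ Ω) :
    ContinuousOn (fun s : ℝ => F (x + s)) (Iic 0) :=
  hF.comp (by fun_prop) fun s hs => hΩ x hx s hs

variable {E : Type*} [NormedAddCommGroup E]

theorem integrableOn_comp_add_ofReal {Ω : Set ℂ} (hΩ : LeftInvariant Ω) {δ : ℝ} (hδ : 0 < δ)
    {C : ℝ} {F : ℂ → E} (hF : ContinuousOn F Ω)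
    (hb : ∀ x ∈ Ω, ‖F x‖ ≤ C * Real.exp (δ * x.re)) {x : ℂ} (hx : x ∈ Ω) :
    IntegrableOn (fun s : ℝ => F (x + s)) (Iic 0) := by
  refine Integrable.mono' (g := fun s : ℝ => C * Real.exp (δ * x.re) * Real.exp (δ * s))
    ((integrableOn_exp_mul_Iic hδ 0).const_mul _)
    ((continuousOn_comp_add_ofReal hΩ hF hx).aestronglyMeasurable measurableSet_Iic) ?_
  filter_upwards [ae_restrict_mem measurableSet_Iic] with s hs
  refine (hb _ (hΩ x hx s hs)).trans_eq ?_
  rw [mul_assoc, ← Real.exp_add]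
  simp [mul_add]

variable [NormedSpace ℂ E]

/-- The integral of `F` over the horizontal half line that ends at `x`. -/
noncomputable def leftIntegral (F : ℂ → E) (x : ℂ) : E := ∫ s in Iic (0 : ℝ), F (x + s)

theorem norm_leftIntegral_le {Ω : Set ℂ} (hΩ : LeftInvariant Ω) {δ : ℝ} (hδ : 0 < δ)
    {C : ℝ} {F : ℂ → E}
    (hb : ∀ x ∈ Ω, ‖F x‖ ≤ C * Real.exp (δ * x.re)) {x : ℂ} (hx : x ∈ Ω) :
    ‖leftIntegral F x‖ ≤ C / δ * Real.exp (δ * x.re) := by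
  have h : ‖leftIntegral F x‖ ≤
      ∫ s in Iic (0 : ℝ), C * Real.exp (δ * x.re) * Real.exp (δ * s) := by
    refine norm_integral_le_of_norm_le ((integrableOn_exp_mul_Iic hδ 0).const_mul _) ?_
    filter_upwards [ae_restrict_mem measurableSet_Iic] with s hs
    refine (hb _ (hΩ x hx s hs)).trans_eq ?_
    rw [mul_assoc, ← Real.exp_add]
    simp [mul_add]
  refine h.trans_eq ?_
  rw [integral_const_mul, integral_exp_mul_Iic hδ]
  simp
  ring

/-- The left integral of an exponentially decaying holomorphic function is a primitive. -/
theorem hasDerivAt_leftIntegral [CompleteSpace E] {Ω : Set ℂ} (hΩo : IsOpen Ω)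
    (hΩ : LeftInvariant Ω) {δ : ℝ} (hδ : 0 < δ) {C : ℝ} {F : ℂ → E} (hF : DifferentiableOn ℂ F Ω)
    (hb : ∀ x ∈ Ω, ‖F x‖ ≤ C * Real.exp (δ * x.re)) {x : ℂ} (hx : x ∈ Ω) :
    HasDerivAt (leftIntegral F) (F x) x := by
  have hC : 0 ≤ C := by
    have := (norm_nonneg _).trans (hb x hx)
    exact nonneg_of_mul_nonneg_left this (Real.exp_pos _)
  obtain ⟨r, hr, hrΩ⟩ := Metric.isOpen_iff.1 hΩo x hx
  have hball : ∀ z ∈ Metric.ball x (r / 2), ∀ w ∈ Metric.closedBall z (r / 3), w ∈ Ω := by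
    intro z hz w hw
    apply hrΩ
    rw [Metric.mem_ball] at *
    rw [Metric.mem_closedBall] at hw
    linarith [dist_triangle w z x]
  have hF' : DifferentiableOn ℂ (deriv F) Ω := hF.deriv hΩo
  -- Cauchy's estimate on discs of radius `r / 3`
  have hder : ∀ z ∈ Metric.ball x (r / 2), ∀ s : ℝ, s ≤ 0 → ‖deriv F (z + s)‖ ≤
      C * Real.exp (δ * (x.re + r)) / (r / 3) * Real.exp (δ * s) := by
    intro z hz s hs
    have hsub : ∀ w ∈ Metric.closedBall (z + s) (r / 3), w ∈ Ω := by
      intro w hw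
      have h1 := hΩ (w - s) (hball z hz _ ?_) s hs
      · simpa using h1
      · rw [Metric.mem_closedBall, dist_eq_norm] at *
        convert! hw using 2
        ring
    have hd : DiffContOnCl ℂ F (Metric.ball (z + s) (r / 3)) := by
      refine DifferentiableOn.diffContOnCl fun w hw => ?_
      exact (hF w (hsub w (Metric.closure_ball_subset_closedBall hw))).mono
        fun w hw => hsub w (Metric.closure_ball_subset_closedBall hw)
    refine (Complex.norm_deriv_le_of_forall_mem_sphere_norm_le (C := C * Real.exp
      (δ * (x.re + r)) * Real.exp (δ * s)) (by positivity) hd fun w hw => ?_).trans_eq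
      (by ring)
    refine (hb w (hsub w (Metric.sphere_subset_closedBall hw))).trans ?_
    rw [mul_assoc, ← Real.exp_add]
    have h1 : w.re ≤ x.re + r + s := by
      have h2 := Complex.abs_re_le_norm (w - (z + s))
      have h3 := Complex.abs_re_le_norm (z - x)
      rw [Metric.mem_sphere, dist_eq_norm] at hw
      rw [Metric.mem_ball, dist_eq_norm] at hz
      simp only [Complex.sub_re, Complex.add_re, Complex.ofReal_re] at h2 h3
      have := le_abs_self (w.re - (z.re + s))
      have := le_abs_self (z.re - x.re)
      linarith
    gcongr
    nlinarith
  have hmem : ∀ z ∈ Metric.ball x (r / 2), z ∈ Ω := fun z hz =>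
    hball z hz z (Metric.mem_closedBall_self (by positivity))
  have key := hasDerivAt_integral_of_dominated_loc_of_deriv_le (𝕜 := ℂ)
    (μ := volume.restrict (Iic (0 : ℝ))) (F := fun z s => F (z + s))
    (F' := fun z s => deriv F (z + s)) (x₀ := x) (s := Metric.ball x (r / 2))
    (bound := fun s => C * Real.exp (δ * (x.re + r)) / (r / 3) * Real.exp (δ * s))
    (Metric.ball_mem_nhds x (by positivity))
    (by
      filter_upwards [Metric.ball_mem_nhds x (half_pos hr)] with z hz
      exact (integrableOn_comp_add_ofReal hΩ hδ hF.continuousOn hb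
        (hmem z hz)).aestronglyMeasurable)
    (integrableOn_comp_add_ofReal hΩ hδ hF.continuousOn hb hx)
    ((continuousOn_comp_add_ofReal hΩ hF'.continuousOn hx).aestronglyMeasurable
      measurableSet_Iic)
    (by
      filter_upwards [ae_restrict_mem measurableSet_Iic] with s hs z hz
      exact hder z hz s hs)
    ((integrableOn_exp_mul_Iic hδ 0).const_mul _)
    (by
      filter_upwards [ae_restrict_mem measurableSet_Iic] with s hs z hz
      exact ((hF.differentiableAt (hΩo.mem_nhds
        (hΩ z (hmem z hz) s hs))).hasDerivAt).comp_add_const z s)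
  have hFTC : ∫ s in Iic (0 : ℝ), deriv F (x + s) = F x := by
    have h1 : ∀ s : ℝ, s ≤ 0 → HasDerivAt (fun s : ℝ => F (x + s)) (deriv F (x + s)) s := by
      intro s hs
      have h2 := ((hF.differentiableAt (hΩo.mem_nhds (hΩ x hx s hs))).hasDerivAt).comp_const_add
        x (s : ℂ)
      simpa [Function.comp_def] using h2.scomp s Complex.ofRealCLM.hasDerivAt
    have h3 := integral_Iic_of_hasDerivAt_of_tendsto (f := fun s : ℝ => F (x + s))
      (f' := fun s : ℝ => deriv F (x + s)) (a := 0) (m := 0)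
      (h1 0 le_rfl).continuousAt.continuousWithinAt (fun s hs => h1 s (le_of_lt hs)) key.1 ?_
    · simpa using h3
    · rw [tendsto_zero_iff_norm_tendsto_zero]
      refine squeeze_zero' (g := fun s : ℝ => C * Real.exp (δ * (x.re + s)))
        (Eventually.of_forall fun s => norm_nonneg _) ?_ ?_
      · filter_upwards [eventually_le_atBot 0] with s hs
        simpa using hb _ (hΩ x hx s hs)
      · have : Tendsto (fun s : ℝ => δ * (x.re + s)) atBot atBot :=
          (tendsto_atBot_add_const_left _ _ tendsto_id).const_mul_atBot hδ
        simpa using (Real.tendsto_exp_atBot.comp this).const_mul C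
  rw [← hFTC]
  exact key.2

/-- Asymptotic integration of `U' = Φ(x, U)` from `-∞`: if `Φ` is Lipschitz in `U` with a constant
`k < δ`, there is a solution that decays like `exp (δ Re x)`. It is the limit of the Picard
iteration `U ↦ ∫_{-∞}^x Φ(·, U)`, and therefore inherits the periods of the equation. -/
theorem exists_solution_of_lipschitz [CompleteSpace E] {Ω : Set ℂ} (hΩo : IsOpen Ω)
    (hΩ : LeftInvariant Ω) {δ k C r : ℝ} (hk : 0 ≤ k) (hkδ : k < δ) (hr : C + k * r ≤ δ * r)
    (hC : 0 ≤ C) {Φ : ℂ → E → E}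
    (h0 : ∀ x ∈ Ω, ‖Φ x 0‖ ≤ C * Real.exp (δ * x.re))
    (hL : ∀ x ∈ Ω, ∀ U V : E, ‖U‖ ≤ r * Real.exp (δ * x.re) → ‖V‖ ≤ r * Real.exp (δ * x.re) →
      ‖Φ x U - Φ x V‖ ≤ k * ‖U - V‖)
    (hd : ∀ U : ℂ → E, DifferentiableOn ℂ U Ω → (∀ x ∈ Ω, ‖U x‖ ≤ r * Real.exp (δ * x.re)) →
      DifferentiableOn ℂ (fun x => Φ x (U x)) Ω) :
    ∃ U : ℂ → E, (∀ x ∈ Ω, ‖U x‖ ≤ r * Real.exp (δ * x.re)) ∧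
      (∀ x ∈ Ω, HasDerivAt U (Φ x (U x)) x) ∧
      ∀ P : ℂ, (∀ x ∈ Ω, x + P ∈ Ω) → (∀ x V, Φ (x + P) V = Φ x V) →
        ∀ x ∈ Ω, U (x + P) = U x := by
  have hδ : 0 < δ := hk.trans_lt hkδ
  have hr0 : 0 ≤ r := by
    by_contra! h
    nlinarith
  set T : (ℂ → E) → ℂ → E := fun U => leftIntegral fun x => Φ x (U x) with hT
  set good : (ℂ → E) → Prop := fun U => DifferentiableOn ℂ U Ω ∧
    ∀ x ∈ Ω, ‖U x‖ ≤ r * Real.exp (δ * x.re) with hgood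
  have hzero : ∀ x : ℂ, ‖(0 : E)‖ ≤ r * Real.exp (δ * x.re) := fun x => by
    rw [norm_zero]; positivity
  have hbound : ∀ U, good U → ∀ x ∈ Ω, ‖Φ x (U x)‖ ≤ δ * r * Real.exp (δ * x.re) := by
    intro U hU x hx
    have h1 := hL x hx (U x) 0 (hU.2 x hx) (hzero x)
    have h2 := h0 x hx
    have h3 := hU.2 x hx
    have h4 : ‖Φ x (U x)‖ ≤ ‖Φ x (U x) - Φ x 0‖ + ‖Φ x 0‖ := by
      simpa using norm_add_le (Φ x (U x) - Φ x 0) (Φ x 0)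
    rw [sub_zero] at h1
    have h5 := mul_le_mul_of_nonneg_left h3 hk
    have h6 := mul_le_mul_of_nonneg_right hr (Real.exp_pos (δ * x.re)).le
    linarith
  have hderiv : ∀ U, good U → ∀ x ∈ Ω, HasDerivAt (T U) (Φ x (U x)) x := fun U hU x hx =>
    hasDerivAt_leftIntegral hΩo hΩ hδ (hd U hU.1 hU.2) (hbound U hU) hx
  have hTgood : ∀ U, good U → good (T U) := by
    intro U hU
    refine ⟨fun x hx => (hderiv U hU x hx).differentiableAt.differentiableWithinAt,
      fun x hx => ?_⟩
    have := norm_leftIntegral_le hΩ hδ (hbound U hU) hx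
    rwa [mul_div_cancel_left₀ _ hδ.ne'] at this
  have hcontr : ∀ U V, good U → good V → ∀ d : ℝ,
      (∀ x ∈ Ω, ‖U x - V x‖ ≤ d * Real.exp (δ * x.re)) →
      ∀ x ∈ Ω, ‖T U x - T V x‖ ≤ k / δ * d * Real.exp (δ * x.re) := by
    intro U V hU hV d hUV x hx
    have h1 : T U x - T V x = leftIntegral (fun x => Φ x (U x) - Φ x (V x)) x := by
      simp only [hT, leftIntegral]
      rw [integral_sub]
      · exact integrableOn_comp_add_ofReal hΩ hδ (hd U hU.1 hU.2).continuousOn (hbound U hU) hx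
      · exact integrableOn_comp_add_ofReal hΩ hδ (hd V hV.1 hV.2).continuousOn (hbound V hV) hx
    rw [h1]
    refine (norm_leftIntegral_le hΩ hδ (C := k * d) (fun y hy => ?_) hx).trans_eq (by ring)
    refine (hL y hy _ _ (hU.2 y hy) (hV.2 y hy)).trans ?_
    rw [mul_assoc]
    exact mul_le_mul_of_nonneg_left (hUV y hy) hk
  set f : ℕ → ℂ → E := fun j => T^[j] 0 with hf
  have hfs : ∀ j, f (j + 1) = T (f j) := fun j => Function.iterate_succ_apply' T j 0
  have hfgood : ∀ j, good (f j) := by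
    intro j
    induction j with
    | zero => exact ⟨differentiableOn_const 0, fun x _ => hzero x⟩
    | succ j ih => rw [hfs]; exact hTgood _ ih
  have hρ : k / δ < 1 := (div_lt_one hδ).2 hkδ
  have hρ0 : 0 ≤ k / δ := by positivity
  have hstep : ∀ j, ∀ x ∈ Ω, ‖f j x - f (j + 1) x‖ ≤ (k / δ) ^ j * r * Real.exp (δ * x.re) := by
    intro j
    induction j with
    | zero =>
      intro x hx
      have h1 := (hfgood 1).2 x hx
      have h2 : f 0 x = 0 := rfl
      rw [h2, zero_sub, norm_neg]
      simpa using h1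
    | succ j ih =>
      intro x hx
      have h1 := hcontr _ _ (hfgood j) (hfgood (j + 1)) _ ih x hx
      rw [← hfs, ← hfs] at h1
      refine h1.trans_eq ?_
      ring
  have hstep' : ∀ x ∈ Ω, ∀ j, dist (f j x) (f (j + 1) x) ≤
      r * Real.exp (δ * x.re) * (k / δ) ^ j := by
    intro x hx j
    rw [dist_eq_norm]
    exact (hstep j x hx).trans_eq (by ring)
  have hlim : ∀ x, ∃ y, x ∈ Ω → Tendsto (fun j => f j x) atTop (𝓝 y) := by
    intro x
    by_cases hx : x ∈ Ω
    · obtain ⟨y, hy⟩ := cauchySeq_tendsto_of_complete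
        (cauchySeq_of_le_geometric _ _ hρ (hstep' x hx))
      exact ⟨y, fun _ => hy⟩
    · exact ⟨0, fun h => absurd h hx⟩
  choose U hU using hlim
  have hdist : ∀ x ∈ Ω, ∀ j, ‖f j x - U x‖ ≤
      r / (1 - k / δ) * (k / δ) ^ j * Real.exp (δ * x.re) := by
    intro x hx j
    have := dist_le_of_le_geometric_of_tendsto _ _ hρ (hstep' x hx) (hU x hx) j
    rw [dist_eq_norm] at this
    exact this.trans_eq (by ring)
  have hpow : Tendsto (fun j : ℕ => (k / δ) ^ j) atTop (𝓝 0) :=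
    tendsto_pow_atTop_nhds_zero_of_lt_one hρ0 hρ
  have hUb : ∀ x ∈ Ω, ‖U x‖ ≤ r * Real.exp (δ * x.re) := fun x hx =>
    le_of_tendsto (hU x hx).norm (Eventually.of_forall fun j => (hfgood j).2 x hx)
  have hUd : DifferentiableOn ℂ U Ω := by
    refine TendstoLocallyUniformlyOn.differentiableOn (F := f) (φ := atTop) ?_
      (Eventually.of_forall fun j => (hfgood j).1) hΩo
    rw [Metric.tendstoLocallyUniformlyOn_iff]
    intro ε hε x hx
    set B := Real.exp (δ * (x.re + 1)) with hB
    have h1 : Tendsto (fun j : ℕ => r / (1 - k / δ) * (k / δ) ^ j * B) atTop (𝓝 0) := by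
      simpa using (hpow.const_mul (r / (1 - k / δ))).mul_const B
    have h2 : ∀ᶠ z in 𝓝[Ω] x, z ∈ Ω ∧ z.re < x.re + 1 := by
      refine eventually_mem_nhdsWithin.and (mem_nhdsWithin_of_mem_nhds ?_)
      exact (isOpen_lt Complex.continuous_re continuous_const).mem_nhds (by simp)
    refine ⟨{z | z ∈ Ω ∧ z.re < x.re + 1}, h2, ?_⟩
    filter_upwards [h1.eventually_lt_const hε] with j hj z hz
    rw [dist_comm, dist_eq_norm]
    refine lt_of_le_of_lt ((hdist z hz.1 j).trans ?_) hj
    have h3 : Real.exp (δ * z.re) ≤ B := by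
      rw [hB]
      gcongr
      exact hz.2.le
    have : 0 ≤ r / (1 - k / δ) := div_nonneg hr0 (by linarith)
    gcongr
  have hUgood : good U := ⟨hUd, hUb⟩
  have hfix : ∀ x ∈ Ω, T U x = U x := by
    intro x hx
    have h1 : Tendsto (fun j => f (j + 1) x) atTop (𝓝 (U x)) :=
      (hU x hx).comp (tendsto_add_atTop_nat 1)
    refine tendsto_nhds_unique ?_ h1
    rw [tendsto_iff_norm_sub_tendsto_zero]
    refine squeeze_zero (fun _ => norm_nonneg _) (fun j => ?_)
      (g := fun j => k / δ * (r / (1 - k / δ) * (k / δ) ^ j) * Real.exp (δ * x.re)) ?_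
    · rw [hfs]
      exact hcontr _ _ (hfgood j) hUgood _ (fun y hy => hdist y hy j) x hx
    · simpa using ((hpow.const_mul (r / (1 - k / δ))).const_mul (k / δ)).mul_const
        (Real.exp (δ * x.re))
  refine ⟨U, hUb, fun x hx => ?_, fun P hP hΦP x hx => ?_⟩
  · refine (hderiv U hUgood x hx).congr_of_eventuallyEq ?_
    filter_upwards [hΩo.mem_nhds hx] with z hz
    exact (hfix z hz).symm
  · have hper : ∀ j, ∀ x ∈ Ω, f j (x + P) = f j x := by
      intro j
      induction j with
      | zero => intro x _; rfl
      | succ j ih =>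
        intro x hx
        rw [hfs]
        simp only [hT, leftIntegral]
        refine setIntegral_congr_fun measurableSet_Iic fun s hs => ?_
        have : x + P + s = x + s + P := by ring
        simp only [this, hΦP]
        rw [ih _ (hΩ x hx s hs)]
    refine tendsto_nhds_unique (hU _ (hP x hx)) ?_
    simpa only [hper _ x hx] using hU x hx

end AsymptoticIntegration

/-! ### The case `n = 1`: Painlevé XXXIV and Painlevé II -/

section PainleveII

/-- `p` is a holomorphic solution without zeros on `V` of Painlevé XXXIV,
`p'' = p'² / (2 p) + 2 p² - s p - k² / (2 p)`. -/
def IsPainleveXXXIVSolution (k : ℂ) (V : Set ℂ) (p : ℂ → ℂ) : Prop :=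
  DifferentiableOn ℂ p V ∧ ∀ s ∈ V, p s ≠ 0 ∧
    deriv (deriv p) s = deriv p s ^ 2 / (2 * p s) + 2 * p s ^ 2 - s * p s - k ^ 2 / (2 * p s)

theorem hasDerivAt_deriv_of_differentiableOn {V : Set ℂ} (hV : IsOpen V) {f : ℂ → ℂ}
    (hf : DifferentiableOn ℂ f V) {s : ℂ} (hs : s ∈ V) :
    HasDerivAt f (deriv f s) s ∧ HasDerivAt (deriv f) (deriv (deriv f) s) s :=
  ⟨(hf.differentiableAt (hV.mem_nhds hs)).hasDerivAt,
    ((hf.deriv hV).differentiableAt (hV.mem_nhds hs)).hasDerivAt⟩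

theorem IsPainleveXXXIVSolution.miura_eq {k : ℂ} {V : Set ℂ} (hV : IsOpen V) {p : ℂ → ℂ}
    (h : IsPainleveXXXIVSolution k V p) {s : ℂ} (hs : s ∈ V) :
    HasDerivAt (fun s => (deriv p s - k) / (2 * p s))
      (p s - ((deriv p s - k) / (2 * p s)) ^ 2 - s / 2) s := by
  obtain ⟨h1, h2⟩ := hasDerivAt_deriv_of_differentiableOn hV h.1 hs
  obtain ⟨h0, h3⟩ := h.2 s hs
  refine ((h2.sub_const k).div (h1.const_mul 2) (mul_ne_zero two_ne_zero h0)).congr_deriv ?_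
  rw [h3]
  field_simp
  ring

/-- The function `q = (p' - k) / (2 p)` solves Painlevé II and recovers `p = q' + q² + s / 2`. -/
theorem IsPainleveXXXIVSolution.isPainleveIISolution {α : ℂ} {V : Set ℂ} (hV : IsOpen V)
    {p q : ℂ → ℂ} (h : IsPainleveXXXIVSolution (α + 1 / 2) V p)
    (hq : ∀ s ∈ V, q s = (deriv p s - (α + 1 / 2)) / (2 * p s)) :
    IsPainleveIISolution α V q ∧ ∀ s ∈ V, miura q s = p s := by
  have hd : ∀ s ∈ V, HasDerivAt q (p s - q s ^ 2 - s / 2) s := by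
    intro s hs
    have := h.miura_eq hV hs
    rw [← hq s hs] at this
    refine this.congr_of_eventuallyEq ?_
    filter_upwards [hV.mem_nhds hs] with t ht using hq t ht
  refine ⟨⟨fun s hs => (hd s hs).differentiableAt.differentiableWithinAt, fun s hs => ?_⟩,
    fun s hs => ?_⟩
  · have h1 : deriv q =ᶠ[𝓝 s] fun t => p t - q t ^ 2 - t / 2 := by
      filter_upwards [hV.mem_nhds hs] with t ht using (hd t ht).deriv
    have h2 := (((hasDerivAt_deriv_of_differentiableOn hV h.1 hs).1.sub
      ((hd s hs).pow 2)).sub ((hasDerivAt_id s).div_const 2)).deriv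
    have h0 := (h.2 s hs).1
    have hp : deriv p s = 2 * q s * p s + (α + 1 / 2) := by
      rw [hq s hs]
      field_simp
      ring
    rw [h1.deriv_eq]
    refine Eq.trans ?_ (h2.trans ?_)
    · rfl
    · rw [hp]
      push_cast
      ring
  · rw [miura, (hd s hs).deriv]
    ring

/-- Conversely `p = q' + q² + s / 2` satisfies `p' = 2 q p + α + 1 / 2`, and it solves Painlevé
XXXIV where it has no zeros. -/
theorem IsPainleveIISolution.hasDerivAt_miura {α : ℂ} {V : Set ℂ} (hV : IsOpen V) {q : ℂ → ℂ}
    (h : IsPainleveIISolution α V q) {s : ℂ} (hs : s ∈ V) :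
    HasDerivAt (miura q) (2 * q s * miura q s + (α + 1 / 2)) s := by
  obtain ⟨h1, h2⟩ := hasDerivAt_deriv_of_differentiableOn hV h.1 hs
  refine ((h2.add (h1.pow 2)).add ((hasDerivAt_id s).div_const 2)).congr_deriv ?_
  rw [h.2 s hs, miura]
  push_cast
  ring

theorem IsPainleveIISolution.isPainleveXXXIVSolution {α : ℂ} {V : Set ℂ} (hV : IsOpen V)
    {q : ℂ → ℂ} (h : IsPainleveIISolution α V q) (h0 : ∀ s ∈ V, miura q s ≠ 0) :
    IsPainleveXXXIVSolution (α + 1 / 2) V (miura q) := by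
  refine ⟨fun s hs => (h.hasDerivAt_miura hV hs).differentiableAt.differentiableWithinAt,
    fun s hs => ⟨h0 s hs, ?_⟩⟩
  have h1 : deriv (miura q) =ᶠ[𝓝 s] fun t => 2 * q t * miura q t + (α + 1 / 2) := by
    filter_upwards [hV.mem_nhds hs] with t ht using (h.hasDerivAt_miura hV ht).deriv
  have hq := (hasDerivAt_deriv_of_differentiableOn hV h.1 hs).1
  have h2 := (((hq.const_mul 2).mul (h.hasDerivAt_miura hV hs)).add_const (α + 1 / 2)).deriv
  have h3 : deriv q s = miura q s - q s ^ 2 - s / 2 := by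
    rw [miura]
    ring
  rw [h1.deriv_eq, h1.eq_of_nhds]
  refine Eq.trans ?_ (h2.trans ?_)
  · rfl
  · rw [h3]
    have := h0 s hs
    field_simp
    ring

namespace QuadricConstants

theorem D_one (K : QuadricConstants 1) (Z : ℂ) :
    K.D Z = K.φ * (-2 * Z + K.X₀ 0 0) - K.ε 0 ^ 2 := by
  let e : Fin 2 ≃ Fin 1 ⊕ Unit := Equiv.ofBijective ![Sum.inl 0, Sum.inr ()] (by decide)
  rw [D, ← Matrix.det_submatrix_equiv_self e, Matrix.det_fin_two]
  simp [e, lowerBlock, matrixX]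
  ring

theorem E_one (K : QuadricConstants 1) (Z : ℂ) :
    K.E Z = -K.φ * K.β 0 ^ 2 + 2 * K.β 0 * K.ε 0 * Z - Z ^ 2 * (-2 * Z + K.X₀ 0 0) := by
  let e : Fin 3 ≃ Unit ⊕ (Fin 1 ⊕ Unit) :=
    Equiv.ofBijective ![Sum.inl (), Sum.inr (Sum.inl 0), Sum.inr (Sum.inr ())] (by decide)
  rw [E, ← Matrix.det_submatrix_equiv_self e, Matrix.det_fin_three]
  simp [e, matrixN, lowerBlock, matrixX]
  ring

/-- For `n = 1`, an affine change of variables turns the right-hand side of the reduced equation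
into that of Painlevé XXXIV. -/
theorem exists_affine_change (K : QuadricConstants 1) (hφ : K.φ ≠ 0) {ζ : ℂ} (hζ : ζ ≠ 0) :
    ∃ α z₀ l μ ν : ℂ, l ≠ 0 ∧ μ ≠ 0 ∧ (∀ p : ℂ, K.D (z₀ + l * p) ≠ 0 ↔ p ≠ 0) ∧
      ∀ p p' u : ℂ, p ≠ 0 →
        K.A (z₀ + l * p) * (μ * (l * p')) ^ 2 + K.B ζ (z₀ + l * p) +
            K.C ζ (z₀ + l * p) * u ^ 1 =
          μ ^ 2 * l * (p' ^ 2 / (2 * p) + 2 * p ^ 2 - (μ * u + ν) * p -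
            (α + 1 / 2) ^ 2 / (2 * p)) := by
  set φ := K.φ with hφdef
  set x₀ := K.X₀ 0 0
  set ε := K.ε 0
  set β := K.β 0
  -- `μ` and `l` are determined by the coefficients `-s p` and `2 p²` of Painlevé XXXIV
  obtain ⟨μ, hμ⟩ := IsAlgClosed.exists_pow_nat_eq (-φ / (2 * ζ)) (n := 3) (by norm_num)
  have hμ0 : μ ≠ 0 := by
    rintro rfl
    have : φ / (2 * ζ) ≠ 0 := div_ne_zero hφ (mul_ne_zero two_ne_zero hζ)
    apply this
    rw [neg_div] at hμ
    simpa using hμ.symm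
  have hφe : φ = -2 * ζ * μ ^ 3 := by
    rw [hμ]
    field_simp
  set z₀ := x₀ / 2 - ε ^ 2 / (2 * φ) with hz₀
  set l := 4 * ζ * μ ^ 2 with hl
  have hl0 : l ≠ 0 := mul_ne_zero (mul_ne_zero (by norm_num) hζ) (pow_ne_zero _ hμ0)
  have hD : ∀ Z, K.D Z = -2 * φ * (Z - z₀) := by
    intro Z
    rw [D_one, hz₀]
    field_simp
    ring
  have hD' : ∀ Z, deriv K.D Z = -2 * φ := by
    intro Z
    rw [funext hD]
    simp
  have hE' : ∀ Z, deriv K.E Z = 2 * β * ε + 6 * Z ^ 2 - 2 * Z * x₀ := by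
    intro Z
    have h1 : HasDerivAt K.E (2 * β * ε - (2 * Z * (-2 * Z + x₀) + Z ^ 2 * -2)) Z := by
      rw [funext K.E_one]
      have h2 := ((hasDerivAt_id Z).const_mul (2 * K.β 0 * K.ε 0)).const_add
        (-K.φ * K.β 0 ^ 2)
      have h3 := ((hasDerivAt_id Z).pow 2).mul
        (((hasDerivAt_id Z).const_mul (-2)).add_const (K.X₀ 0 0))
      refine (h2.sub h3).congr_deriv ?_
      simp [β, ε, x₀]
    rw [h1.deriv]
    ring
  -- `e₀` and `e₂` are coefficients of `E` as a polynomial in `Z - z₀`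
  set e₀ := -φ * β ^ 2 + 2 * β * ε * z₀ - z₀ ^ 2 * (-2 * z₀ + x₀) with he₀
  set e₂ := 6 * z₀ - x₀ with he₂
  obtain ⟨k, hk⟩ := IsAlgClosed.exists_pow_nat_eq (e₀ / (4 * ζ * l ^ 2 * μ ^ 2)) (n := 2)
    (by norm_num)
  refine ⟨k - 1 / 2, z₀, l, μ, -e₂ / (8 * ζ * μ ^ 2), hl0, hμ0, fun p => ?_, fun p p' u hp => ?_⟩
  · rw [hD]
    simp [hφ, hl0]
  · have hk' : (k - 1 / 2 + 1 / 2) ^ 2 = e₀ / (4 * ζ * l ^ 2 * μ ^ 2) := by rw [← hk]; ring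
    rw [hk', A, B, C, hD', hE', hD, E_one]
    simp only [add_sub_cancel_left]
    rw [show K.φ = φ from rfl, show K.X₀ 0 0 = x₀ from rfl, show K.ε 0 = ε from rfl,
      show K.β 0 = β from rfl, he₂, he₀]
    clear_value φ x₀ ε β z₀
    subst hφe
    rw [hl]
    field_simp
    ring

end QuadricConstants

/-- An affine change of variables between Painlevé XXXIV and an equation for `Z`. -/
theorem isPainleveXXXIVSolution_rescale_iff {n : ℕ} (K : QuadricConstants n) {ζ k z₀ l μ ν : ℂ}
    (hl : l ≠ 0) (hμ : μ ≠ 0) (hD : ∀ p : ℂ, K.D (z₀ + l * p) ≠ 0 ↔ p ≠ 0)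
    (hODE : ∀ p p' u : ℂ, p ≠ 0 →
        K.A (z₀ + l * p) * (μ * (l * p')) ^ 2 + K.B ζ (z₀ + l * p) +
            K.C ζ (z₀ + l * p) * u ^ 1 =
          μ ^ 2 * l * (p' ^ 2 / (2 * p) + 2 * p ^ 2 - (μ * u + ν) * p - k ^ 2 / (2 * p)))
    {U : Set ℂ} (hU : IsOpen U) {Z p : ℂ → ℂ} (hZ : ∀ u ∈ U, Z u = z₀ + l * p (μ * u + ν)) :
    K.IsReducedSolution ζ 1 U Z ↔
      IsPainleveXXXIVSolution k ((fun s => (s - ν) / μ) ⁻¹' U) p := by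
  set V := (fun s => (s - ν) / μ) ⁻¹' U with hVdef
  have hV : IsOpen V := hU.preimage (by fun_prop)
  have huV : ∀ u ∈ U, μ * u + ν ∈ V := by
    intro u hu
    simpa [hVdef, hμ] using hu
  have hp : ∀ s ∈ V, p s = (Z ((s - ν) / μ) - z₀) / l := by
    intro s hs
    have h1 := hZ _ hs
    have h2 : μ * ((s - ν) / μ) + ν = s := by field_simp; ring
    rw [h2] at h1
    rw [h1]
    field_simp
    ring
  have hdiff : DifferentiableOn ℂ Z U ↔ DifferentiableOn ℂ p V := by
    constructor
    · intro h
      have h1 : DifferentiableOn ℂ (fun s => (Z ((s - ν) / μ) - z₀) / l) V :=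
        ((h.comp (f := fun s => (s - ν) / μ) (by fun_prop) fun s hs => hs).sub_const
          z₀).div_const l
      exact h1.congr hp
    · intro h
      have h1 : DifferentiableOn ℂ (fun u => z₀ + l * p (μ * u + ν)) U :=
        ((h.comp (by fun_prop) huV).const_mul l).const_add z₀
      exact h1.congr hZ
  have hmain : DifferentiableOn ℂ p V → ∀ u ∈ U, deriv Z u = μ * (l * deriv p (μ * u + ν)) ∧
      deriv (deriv Z) u = μ ^ 2 * l * deriv (deriv p) (μ * u + ν) := by
    intro h
    have ha : ∀ u : ℂ, HasDerivAt (fun u => μ * u + ν) μ u := fun u => by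
      simpa using ((hasDerivAt_id u).const_mul μ).add_const ν
    have h1 : ∀ u ∈ U, HasDerivAt Z (μ * (l * deriv p (μ * u + ν))) u := by
      intro u hu
      have h2 := (hasDerivAt_deriv_of_differentiableOn hV h (huV u hu)).1
      have h3 := ((h2.comp u (ha u)).const_mul l).const_add z₀
      refine (h3.congr_deriv (by ring)).congr_of_eventuallyEq ?_
      filter_upwards [hU.mem_nhds hu] with v hv using hZ v hv
    refine fun u hu => ⟨(h1 u hu).deriv, ?_⟩
    have h2 : deriv Z =ᶠ[𝓝 u] fun u => μ * (l * deriv p (μ * u + ν)) := by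
      filter_upwards [hU.mem_nhds hu] with v hv using (h1 v hv).deriv
    rw [h2.deriv_eq]
    have h3 := (hasDerivAt_deriv_of_differentiableOn hV h (huV u hu)).2
    have h4 := ((h3.comp u (ha u)).const_mul l).const_mul μ
    exact h4.deriv.trans (by ring)
  have hfac : μ ^ 2 * l ≠ 0 := mul_ne_zero (pow_ne_zero _ hμ) hl
  rw [QuadricConstants.IsReducedSolution, IsPainleveXXXIVSolution, hdiff]
  refine and_congr_right fun h => ⟨fun hs s hsV => ?_, fun hs u hu => ?_⟩
  · obtain ⟨h1, h2⟩ := hs _ hsV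
    obtain ⟨h3, h4⟩ := hmain h _ hsV
    have h5 : μ * ((s - ν) / μ) + ν = s := by field_simp; ring
    rw [hZ _ hsV, hD, h5] at h1
    refine ⟨h1, ?_⟩
    rw [h3, h4, hZ _ hsV, hODE _ _ _ (by rwa [h5]), h5] at h2
    exact mul_left_cancel₀ hfac h2
  · obtain ⟨h1, h2⟩ := hs _ (huV u hu)
    obtain ⟨h3, h4⟩ := hmain h _ hu
    rw [hZ _ hu, hD]
    refine ⟨h1, ?_⟩
    rw [h3, h4, hODE _ _ _ h1, h2]

theorem isEquivalentToPainleveII_of_one (K : QuadricConstants 1) (hφ : K.φ ≠ 0) {ζ : ℂ}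
    (hζ : ζ ≠ 0) : IsEquivalentToPainleveII (K.IsReducedSolution ζ 1) := by
  obtain ⟨α, z₀, l, μ, ν, hl, hμ, hD, hODE⟩ := K.exists_affine_change hφ hζ
  refine ⟨α, z₀, l, μ, ν, hl, hμ, fun U hU => ?_⟩
  set V := (fun s => (s - ν) / μ) ⁻¹' U with hVdef
  have hV : IsOpen V := hU.preimage (by fun_prop)
  have huV : ∀ u ∈ U, μ * u + ν ∈ V := by
    intro u hu
    simpa [hVdef, hμ] using hu
  refine ⟨fun Z hZ => ?_, fun q hq h0 => ?_⟩
  · set p := rescale z₀ l μ ν Z with hp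
    have hZp : ∀ u ∈ U, Z u = z₀ + l * p (μ * u + ν) := by
      intro u _
      have h5 : (μ * u + ν - ν) / μ = u := by field_simp; ring
      rw [hp, rescale, h5]
      field_simp
      ring
    have h1 := (isPainleveXXXIVSolution_rescale_iff K hl hμ hD hODE hU hZp).1 hZ
    obtain ⟨h2, h3⟩ := h1.isPainleveIISolution hV (q := toPainleveII α z₀ l μ ν Z)
      fun s _ => by rw [toPainleveII, sub_sub]
    refine ⟨h2, fun s hs => ?_, fun u hu => ?_⟩
    · rw [h3 s hs]
      exact (h1.2 s hs).1
    · rw [ofPainleveII, h3 _ (huV u hu), ← hZp u hu]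
  · have h1 := hq.isPainleveXXXIVSolution hV h0
    refine ⟨(isPainleveXXXIVSolution_rescale_iff K hl hμ hD hODE hU fun u _ => rfl).2 h1,
      fun s hs => ?_⟩
    have h2 : rescale z₀ l μ ν (ofPainleveII z₀ l μ ν q) = miura q := by
      funext s
      rw [rescale, ofPainleveII]
      have h5 : μ * ((s - ν) / μ) + ν = s := by field_simp; ring
      rw [h5]
      field_simp
      ring
    rw [toPainleveII, h2, (hq.hasDerivAt_miura hV hs).deriv]
    have := h0 s hs
    field_simp
    ring

end PainleveII

/-! ### The expansions of `D` and `E` at infinity -/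

section Determinants

open Polynomial

theorem exists_polynomial_eval_eq_det {ι : Type*} [Fintype ι] [DecidableEq ι]
    (A B : Matrix ι ι ℂ) :
    ∃ P : ℂ[X], ∀ q : ℂ, (B + q • A).det = B.det + P.eval q * q := by
  set R : ℂ[X] := ((X : ℂ[X]) • A.map C + B.map C).det with hR
  have hev : ∀ q : ℂ, (B + q • A).det = R.eval q := by
    intro q
    rw [hR, ← Polynomial.coe_evalRingHom, RingHom.map_det]
    congr 1
    ext i j
    simp
    ring
  refine ⟨R.divX, fun q => ?_⟩
  have h0 : R.coeff 0 = B.det := coeff_det_X_add_C_zero A B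
  rw [hev, ← h0]
  conv_lhs => rw [← R.divX_mul_X_add]
  simp [add_comm]

namespace QuadricConstants

variable {n : ℕ} (K : QuadricConstants n)

/-- The expansion of `D` at infinity. -/
theorem exists_polynomial_D : ∃ P : ℂ[X], ∀ Z : ℂ, Z ≠ 0 →
    K.D Z = -(-2) ^ n * Z ^ n * (-K.φ + P.eval Z⁻¹ * Z⁻¹) := by
  set B : Matrix (Fin n ⊕ Unit) (Fin n ⊕ Unit) ℂ := Matrix.fromBlocks ((-2 : ℂ) • 1) 0
    (Matrix.of fun _ j => K.ε j) (Matrix.of fun _ _ => K.φ) with hB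
  set A : Matrix (Fin n ⊕ Unit) (Fin n ⊕ Unit) ℂ := Matrix.fromBlocks K.X₀
    (Matrix.of fun i _ => K.ε i) 0 0 with hA
  obtain ⟨P, hP⟩ := exists_polynomial_eval_eq_det A B
  have hdetB : B.det = (-2) ^ n * K.φ := by
    rw [hB, Matrix.det_fromBlocks_zero₁₂, Matrix.det_smul]
    simp
  refine ⟨Polynomial.C (-((-2) ^ n)⁻¹) * P, fun Z hZ => ?_⟩
  have h1 : K.lowerBlock Z = Matrix.fromBlocks (Z • 1) 0 0 1 * (B + Z⁻¹ • A) := by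
    rw [hB, hA, Matrix.fromBlocks_smul, Matrix.fromBlocks_add, Matrix.fromBlocks_multiply]
    ext i j
    rcases i with i | i <;> rcases j with j | j <;>
      simp [lowerBlock, matrixX, hZ, mul_add]
    ring
  have h2 : ((-2 : ℂ)) ^ n ≠ 0 := pow_ne_zero _ (by norm_num)
  rw [D, h1, Matrix.det_mul, hP, hdetB, Matrix.det_fromBlocks_zero₁₂, Matrix.det_smul]
  simp
  field_simp
  ring

/-- The expansion of `E` at infinity. Its second coefficient is computed by Jacobi's formula at
the matrix that remains of `Z⁻¹ N` for `Z → ∞`; this matrix is a row permutation of a diagonal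
one. -/
theorem exists_polynomial_E : ∃ P : ℂ[X], ∀ Z : ℂ, Z ≠ 0 →
    K.E Z = -(-2) ^ n * Z ^ (n + 2) *
      (1 - K.X₀.trace / 2 * Z⁻¹ + P.eval Z⁻¹ * Z⁻¹ ^ 2) := by
  set B : Matrix (Unit ⊕ (Fin n ⊕ Unit)) (Unit ⊕ (Fin n ⊕ Unit)) ℂ :=
    Matrix.fromBlocks 0 (Matrix.of fun _ j => Sum.elim 0 1 j)
      (Matrix.of fun i _ => Sum.elim 0 1 i) (Matrix.fromBlocks ((-2 : ℂ) • 1) 0 0 0) with hB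
  set W : Matrix (Unit ⊕ (Fin n ⊕ Unit)) (Unit ⊕ (Fin n ⊕ Unit)) ℂ :=
    Matrix.fromBlocks 0 (Matrix.of fun _ j => Sum.elim 0 1 j)
      (Matrix.of fun i _ => Sum.elim 0 1 i) (Matrix.fromBlocks ((-2 : ℂ)⁻¹ • 1) 0 0 0) with hW
  set A : Matrix (Unit ⊕ (Fin n ⊕ Unit)) (Unit ⊕ (Fin n ⊕ Unit)) ℂ :=
    Matrix.fromBlocks 0 (Matrix.of fun _ j => Sum.elim K.β 0 j)
      (Matrix.of fun i _ => Sum.elim K.β 0 i) (Matrix.fromBlocks K.X₀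
        (Matrix.of fun i _ => K.ε i) (Matrix.of fun _ j => K.ε j)
        (Matrix.of fun _ _ => K.φ)) with hA
  have hBW : B * W = 1 := by
    ext i j
    rcases i with i | i | i <;> rcases j with j | j | j <;>
      simp [hB, hW, Matrix.mul_apply, Fintype.sum_sum_type, Matrix.one_apply]
  have hdetB : B.det = -(-2) ^ n := by
    have h : B = (Matrix.diagonal (Sum.elim (fun _ => 1) (Sum.elim (fun _ => -2) fun _ => 1) :
        Unit ⊕ (Fin n ⊕ Unit) → ℂ)).submatrix
          (Equiv.swap (Sum.inl ()) (Sum.inr (Sum.inr ()))) id := by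
      ext i j
      rcases i with i | i | i <;> rcases j with j | j | j <;>
        simp [hB, Matrix.diagonal_apply, Equiv.swap_apply_def, Matrix.one_apply]
      split_ifs <;> simp
    rw [h, Matrix.det_permute, Matrix.det_diagonal, Equiv.Perm.sign_swap (by simp)]
    simp [Fintype.prod_sum_type]
  have htr : (W * A).trace = -(K.X₀.trace / 2) := by
    simp [hW, hA, Matrix.trace, Matrix.mul_apply, Fintype.sum_sum_type, Matrix.one_apply,
      ← Finset.mul_sum]
    ring
  refine ⟨(1 + (X : ℂ[X]) • (W * A).map Polynomial.C).det.divX.divX, fun Z hZ => ?_⟩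
  have h1 : K.matrixN 0 Z = Z • (B * (1 + Z⁻¹ • (W * A))) := by
    rw [mul_add, mul_smul_comm, ← mul_assoc, hBW, mul_one, one_mul, hB, hA]
    ext i j
    rcases i with i | i | i <;> rcases j with j | j | j <;>
      simp [matrixN, lowerBlock, matrixX, hZ, mul_add]
    ring
  rw [E, h1, Matrix.det_smul, Matrix.det_mul, hdetB, Matrix.det_one_add_smul, htr]
  simp
  ring

end QuadricConstants

end Determinants

/-! ### The scaled equation -/

section ScaledEquation

open Polynomial

/-- The function `S` for which the first integral of the reduced system reads
`(m - (n / 2) m')² = S(m, p, v, J)` in the variable `x = log (u - u₀)`. Here `Z = m / p` with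
`p = exp (2 x / n) / a`, `v = u - u₀`, and `J = p² (Y + 2 u Z)`; the polynomials `P` and `Q` and
the constant `t` come from the expansions of `E` and `D` at infinity. -/
noncomputable def scaledRHS (n : ℕ) (P Q : ℂ[X]) (t φ u₀ m p v J : ℂ) : ℂ :=
  m ^ (n + 2) * (1 - t * (p / m) + P.eval (p / m) * (p / m) ^ 2 +
    (J / m ^ 2 - 2 * (u₀ + v) * (p / m)) * (-φ + Q.eval (p / m) * (p / m)))

variable (n : ℕ) (P Q : ℂ[X]) (t φ u₀ : ℂ)

theorem analyticAt_polynomial_eval (P : ℂ[X]) (z : ℂ) : AnalyticAt ℂ (fun z => P.eval z) z :=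
  P.differentiable.analyticAt z

theorem analyticAt_scaledRHS {z : ℂ × ℂ × ℂ × ℂ} (hz : z.1 ≠ 0) :
    AnalyticAt ℂ (fun z : ℂ × ℂ × ℂ × ℂ =>
      scaledRHS n P Q t φ u₀ z.1 z.2.1 z.2.2.1 z.2.2.2) z := by
  have h1 : AnalyticAt ℂ (fun z : ℂ × ℂ × ℂ × ℂ => z.1) z := analyticAt_fst
  have hs : AnalyticAt ℂ (fun z : ℂ × ℂ × ℂ × ℂ => z.2) z := analyticAt_snd
  have hp : AnalyticAt ℂ (fun z : ℂ × ℂ × ℂ × ℂ => z.2.1) z := analyticAt_fst.fun_comp hs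
  have hss : AnalyticAt ℂ (fun z : ℂ × ℂ × ℂ × ℂ => z.2.2) z := analyticAt_snd.fun_comp hs
  have hv : AnalyticAt ℂ (fun z : ℂ × ℂ × ℂ × ℂ => z.2.2.1) z := analyticAt_fst.fun_comp hss
  have hJ : AnalyticAt ℂ (fun z : ℂ × ℂ × ℂ × ℂ => z.2.2.2) z := analyticAt_snd.fun_comp hss
  have h2 : AnalyticAt ℂ (fun z : ℂ × ℂ × ℂ × ℂ => z.2.1 / z.1) z := by
    exact AnalyticAt.div hp h1 hz
  have h3 : AnalyticAt ℂ (fun z : ℂ × ℂ × ℂ × ℂ => z.2.2.2 / z.1 ^ 2) z := by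
    exact AnalyticAt.div hJ (h1.pow 2) (pow_ne_zero _ hz)
  have hP := (analyticAt_polynomial_eval P _).fun_comp h2
  have hQ := (analyticAt_polynomial_eval Q _).fun_comp h2
  unfold scaledRHS
  fun_prop

theorem scaledRHS_zero {m : ℂ} : scaledRHS n P Q t φ u₀ m 0 0 0 = m ^ (n + 2) := by
  simp [scaledRHS]

/-- The right-hand side of the scaled equation `m' = (2 / n) (m - √S)` (principal branch of the
root), with `m` added: the equation reads `m' + m = scaledField`, and its left-hand side is
integrated by the factor `exp x`. -/
noncomputable def scaledField (z : ℂ × ℂ × ℂ × ℂ) : ℂ :=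
  z.1 + 2 / n * (z.1 - scaledRHS n P Q t φ u₀ z.1 z.2.1 z.2.2.1 z.2.2.2 ^ (1 / 2 : ℂ))

theorem analyticAt_scaledField {z : ℂ × ℂ × ℂ × ℂ} (hz : z.1 ≠ 0)
    (hS : scaledRHS n P Q t φ u₀ z.1 z.2.1 z.2.2.1 z.2.2.2 ∈ Complex.slitPlane) :
    AnalyticAt ℂ (scaledField n P Q t φ u₀) z := by
  have h1 := (analyticAt_scaledRHS n P Q t φ u₀ hz).cpow
    (analyticAt_const (v := (1 / 2 : ℂ))) hS
  have h2 : AnalyticAt ℂ (fun z : ℂ × ℂ × ℂ × ℂ => z.1) z := analyticAt_fst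
  unfold scaledField
  fun_prop

/-- Near the point `(1, 0, 0, 0)` the Lipschitz constant of the field in `m` is arbitrarily small:
its derivative in `m` vanishes there, as `-1` is a characteristic exponent of the equation. -/
theorem exists_scaledField_lipschitz (hn : n ≠ 0) (hφ : φ ≠ 0) {ε : ℝ} (hε : 0 < ε) :
    ∃ r C : ℝ, 0 < r ∧ 0 ≤ C ∧
      (∀ m p v J : ℂ, ‖m - 1‖ < r → ‖p‖ < r → ‖v‖ < r → ‖J‖ < r →
        m ≠ 0 ∧ scaledRHS n P Q t φ u₀ m p v J ∈ Complex.slitPlane ∧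
          -φ + Q.eval (p / m) * (p / m) ≠ 0) ∧
      ∀ m m' p v J J' : ℂ, ‖m - 1‖ < r → ‖m' - 1‖ < r → ‖p‖ < r → ‖v‖ < r → ‖J‖ < r →
        ‖J'‖ < r → ‖scaledField n P Q t φ u₀ (m, p, v, J) -
          scaledField n P Q t φ u₀ (m', p, v, J')‖ ≤ ε * ‖m - m'‖ + C * ‖J - J'‖ := by
  set z₀ : ℂ × ℂ × ℂ × ℂ := (1, 0, 0, 0) with hz₀
  have hS0 : scaledRHS n P Q t φ u₀ z₀.1 z₀.2.1 z₀.2.2.1 z₀.2.2.2 = 1 := by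
    simp [hz₀, scaledRHS_zero]
  have hslit : (1 : ℂ) ∈ Complex.slitPlane := Complex.one_mem_slitPlane
  have hg := (analyticAt_scaledField n P Q t φ u₀ (z := z₀) one_ne_zero
    (by rw [hS0]; exact hslit)).hasStrictFDerivAt
  set Λ := fderiv ℂ (scaledField n P Q t φ u₀) z₀ with hΛ
  have hΛ1 : Λ (1, 0, 0, 0) = 0 := by
    have h1 : HasDerivAt (fun m : ℂ => ((m, 0, 0, 0) : ℂ × ℂ × ℂ × ℂ)) (1, 0, 0, 0) 1 :=
      (hasDerivAt_id (1 : ℂ)).prodMk (hasDerivAt_const (1 : ℂ) ((0, 0, 0) : ℂ × ℂ × ℂ))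
    have h2 := hg.hasFDerivAt.comp_hasDerivAt (1 : ℂ) h1
    have h3 : HasDerivAt (fun m : ℂ => m + 2 / n * (m - (m ^ (n + 2)) ^ (1 / 2 : ℂ)))
        (1 + 2 / n * (1 - (1 / 2 : ℂ) * ((1 : ℂ) ^ (n + 2)) ^ ((1 / 2 : ℂ) - 1) *
          (((n + 2 : ℕ) : ℂ) * (1 : ℂ) ^ (n + 2 - 1)))) 1 := by
      have h4 := (hasDerivAt_pow (n + 2) (1 : ℂ)).cpow_const (c := (1 / 2 : ℂ))
        (by simp)
      exact (hasDerivAt_id (1 : ℂ)).add (((hasDerivAt_id (1 : ℂ)).sub h4).const_mul _)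
    have h5 : (scaledField n P Q t φ u₀ ∘ fun m : ℂ => ((m, 0, 0, 0) : ℂ × ℂ × ℂ × ℂ)) =
        fun m : ℂ => m + 2 / n * (m - (m ^ (n + 2)) ^ (1 / 2 : ℂ)) := by
      funext m
      simp [scaledField, scaledRHS_zero]
    rw [h5] at h2
    rw [h2.unique h3]
    have : (n : ℂ) ≠ 0 := Nat.cast_ne_zero.2 hn
    simp
    field_simp
    ring
  have hnear : ∀ᶠ z : ℂ × ℂ × ℂ × ℂ in 𝓝 z₀, z.1 ≠ 0 ∧
      scaledRHS n P Q t φ u₀ z.1 z.2.1 z.2.2.1 z.2.2.2 ∈ Complex.slitPlane ∧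
        -φ + Q.eval (z.2.1 / z.1) * (z.2.1 / z.1) ≠ 0 := by
    refine (continuousAt_fst.eventually_ne one_ne_zero).and (Eventually.and ?_ ?_)
    · refine (analyticAt_scaledRHS n P Q t φ u₀ (z := z₀) one_ne_zero).continuousAt.eventually_mem
        (Complex.isOpen_slitPlane.mem_nhds ?_)
      rw [hS0]
      exact hslit
    · have hc : ContinuousAt (fun z : ℂ × ℂ × ℂ × ℂ => z.2.1 / z.1) z₀ :=
        ContinuousAt.div (by fun_prop) (by fun_prop) one_ne_zero
      have hc2 : ContinuousAt (fun z : ℂ × ℂ × ℂ × ℂ =>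
          -φ + Q.eval (z.2.1 / z.1) * (z.2.1 / z.1)) z₀ :=
        continuousAt_const.add ((Q.continuous.continuousAt.comp hc).mul hc)
      refine hc2.eventually_ne ?_
      simp [hz₀, hφ]
  have hlip := hg.isLittleO.bound hε
  rw [nhds_prod_eq] at hlip
  obtain ⟨s, hs, hs'⟩ := (eventually_prod_self_iff (r := fun z z' =>
    ‖scaledField n P Q t φ u₀ z - scaledField n P Q t φ u₀ z' - Λ (z - z')‖ ≤
      ε * ‖z - z'‖)).1 hlip
  obtain ⟨r, hr, hrs⟩ := Metric.mem_nhds_iff.1 (inter_mem hs hnear)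
  have hmem : ∀ m p v J : ℂ, ‖m - 1‖ < r → ‖p‖ < r → ‖v‖ < r → ‖J‖ < r →
      ((m, p, v, J) : ℂ × ℂ × ℂ × ℂ) ∈ Metric.ball z₀ r := by
    intro m p v J h1 h2 h3 h4
    simp only [Metric.mem_ball, hz₀, dist_eq_norm]
    simp [h1, h2, h3, h4]
  refine ⟨r, ε + ‖Λ (0, 0, 0, 1)‖, hr, by positivity, fun m p v J h1 h2 h3 h4 =>
    (hrs (hmem m p v J h1 h2 h3 h4)).2, fun m m' p v J J' h1 h1' h2 h3 h4 h4' => ?_⟩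
  have h5 := hs' _ (hrs (hmem m p v J h1 h2 h3 h4)).1 _ (hrs (hmem m' p v J' h1' h2 h3 h4')).1
  simp only [Prod.mk_sub_mk, sub_self] at h5
  have h6 : ((m - m', 0, 0, J - J') : ℂ × ℂ × ℂ × ℂ) =
      (m - m') • (1, 0, 0, 0) + (J - J') • (0, 0, 0, 1) := by simp
  have h7 : Λ (m - m', 0, 0, J - J') = (J - J') * Λ (0, 0, 0, 1) := by
    rw [h6, map_add, map_smul, map_smul, hΛ1]
    simp
  have h8 : ‖((m - m', 0, 0, J - J') : ℂ × ℂ × ℂ × ℂ)‖ ≤ ‖m - m'‖ + ‖J - J'‖ := by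
    simp only [Prod.norm_def, norm_zero]
    have := norm_nonneg (m - m')
    have := norm_nonneg (J - J')
    simp
  rw [h7] at h5
  have h9 := norm_le_norm_add_norm_sub' (scaledField n P Q t φ u₀ (m, p, v, J) -
          scaledField n P Q t φ u₀ (m', p, v, J')) ((J - J') * Λ (0, 0, 0, 1))
  rw [norm_mul] at h9
  have h10 := mul_le_mul_of_nonneg_left h8 hε.le
  linarith

end ScaledEquation

/-! ### The residual of the two-term ansatz -/

section Residual

open Polynomial

theorem exists_one_add_pow_eq (k : ℕ) : ∃ R : ℂ[X], ∀ η : ℂ,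
    (1 + η) ^ k = 1 + k * η + k * (k - 1) / 2 * η ^ 2 + η ^ 3 * R.eval η := by
  induction k with
  | zero => exact ⟨0, fun η => by simp⟩
  | succ k ih =>
    obtain ⟨R, hR⟩ := ih
    refine ⟨Polynomial.C ((k : ℂ) * (k - 1) / 2) + (1 + X) * R, fun η => ?_⟩
    rw [pow_succ, hR]
    simp
    ring

theorem add_mul_sq_isBigO {σ : ℂ} (c l a : ℂ) {l₀ : Filter ℂ} {T : ℂ → ℂ}
    (hT : Tendsto T l₀ (𝓝 0)) (hx : (fun x => σ * x * T x) =O[l₀] fun _ => (1 : ℂ)) :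
    (fun x => (c + l * σ * x) * (T x ^ 2 / a) ^ 2) =O[l₀] fun x => T x ^ 3 := by
  have h0 : (fun x => (c + l * σ * x) * T x) =O[l₀] fun _ => (1 : ℂ) := by
    refine (((hT.isBigO_one ℂ).const_mul_left c).add (hx.const_mul_left l)).congr_left
      fun x => ?_
    ring
  have h1 := ((h0.mul (isBigO_refl (fun x => T x ^ 3) l₀)).const_mul_left (1 / a ^ 2))
  simp only [one_mul] at h1
  refine h1.congr_left fun x => ?_
  ring

/-- The residual of the two-term ansatz `m = 1 + b p + c p² + …` (with a logarithmic term if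
`σ ≠ 0`, that is `n = 2`) in the equation `(m - (n / 2) m')² = S`. The exponent `4` is a resonance:
the coefficient `c` is tied to the constant of integration `c₁` in `Y + 2 u Z` only. -/
theorem scaledRHS_ansatz_isBigO {n : ℕ} (P Q : ℂ[X]) {t φ u₀ a b c c₁ σ : ℂ} (ha : a ≠ 0)
    (hσ : n * σ = 2 * σ) (hb : (n + 2) * b = t - 2 * u₀ * φ)
    (hc : (n + 4) * c + n * (a * φ / 3 * σ) + (n + 2) * (n + 1) / 2 * b ^ 2 +
      (n + 1) * (2 * u₀ * φ - t) * b + (P.eval 0 - 2 * u₀ * Q.eval 0 - φ * c₁ + 2 * φ * a * σ) = 0)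
    {l₀ : Filter ℂ} {T v J : ℂ → ℂ} (hT : Tendsto T l₀ (𝓝 0)) (hT0 : ∀ x, T x ≠ 0)
    (hx : (fun x => σ * x * T x) =O[l₀] fun _ => (1 : ℂ))
    (hv : (fun x => v x / (T x ^ 2 / a) - a * σ) =O[l₀] T)
    (hJ : (fun x => J x - (c₁ + 2 * a * σ * x)) =O[l₀] T)
    {p m : ℂ → ℂ} (hp : ∀ x, p x = T x ^ 2 / a)
    (hm : ∀ x, m x = 1 + b * p x + (c + a * φ / 3 * σ * x) * p x ^ 2) :
    (fun x => scaledRHS n P Q t φ u₀ (m x) (p x) (v x) (J x * p x ^ 2) -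
      (1 - (c + a * φ / 3 * σ * x) * p x ^ 2 - n / 2 * (a * φ / 3 * σ) * p x ^ 2) ^ 2)
      =O[l₀] fun x => T x ^ 5 := by
  set l := a * φ / 3 * σ with hl
  have hTO : T =O[l₀] fun _ => (1 : ℂ) := hT.isBigO_one ℂ
  have hpow : ∀ {i j : ℕ}, i ≤ j → (fun x => T x ^ j) =O[l₀] fun x => T x ^ i := by
    intro i j hij
    obtain ⟨k, rfl⟩ := Nat.exists_eq_add_of_le hij
    have := (isBigO_refl (fun x => T x ^ i) l₀).mul (hTO.pow k)
    simpa [pow_add] using this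
  have hp0 : ∀ x, p x ≠ 0 := fun x => by
    rw [hp]
    exact div_ne_zero (pow_ne_zero _ (hT0 x)) ha
  have hpO : p =O[l₀] fun x => T x ^ 2 := by
    refine IsBigO.of_bound ‖a⁻¹‖ (Eventually.of_forall fun x => ?_)
    rw [hp, div_eq_inv_mul, norm_mul]
  set w : ℂ → ℂ := fun x => (c + l * x) * p x ^ 2 with hw
  have hwO : w =O[l₀] fun x => T x ^ 3 := by
    refine (add_mul_sq_isBigO c (a * φ / 3) a hT hx).congr_left fun x => ?_
    simp only [hw, hp, hl]
  set η : ℂ → ℂ := fun x => b * p x + w x with hη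
  have hηO : η =O[l₀] fun x => T x ^ 2 :=
    (hpO.const_mul_left b).add (hwO.trans (hpow (by norm_num)))
  have hη0 : Tendsto η l₀ (𝓝 0) := by
    refine hηO.trans_tendsto ?_
    simpa using hT.pow 2
  have hmη : ∀ x, m x = 1 + η x := fun x => by
    rw [hm, hη, hw]
    ring
  have hm1 : Tendsto m l₀ (𝓝 1) := by
    rw [funext hmη]
    simpa using hη0.const_add 1
  have hm0 : ∀ᶠ x in l₀, m x ≠ 0 := hm1.eventually_ne one_ne_zero
  -- Taylor expansions of the powers of `m`
  have hpow2 : ∀ k : ℕ, (fun x => m x ^ k - (1 + k * η x + k * (k - 1) / 2 * η x ^ 2))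
      =O[l₀] fun x => T x ^ 5 := by
    intro k
    obtain ⟨R, hR⟩ := exists_one_add_pow_eq k
    have h1 : (fun x => R.eval (η x)) =O[l₀] fun _ => (1 : ℂ) :=
      (R.continuous.continuousAt.tendsto.comp hη0).isBigO_one ℂ
    have h2 := (hηO.pow 3).mul h1
    simp only [mul_one, ← pow_mul] at h2
    refine (h2.trans (hpow (by norm_num))).congr_left fun x => ?_
    rw [hmη, hR]
    ring
  have hpow1 : ∀ k : ℕ, (fun x => m x ^ k - (1 + k * η x)) =O[l₀] fun x => T x ^ 4 := by
    intro k
    have h1 := ((hηO.pow 2).const_mul_left ((k : ℂ) * (k - 1) / 2))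
    simp only [← pow_mul] at h1
    refine (((hpow2 k).trans (hpow (by norm_num : 4 ≤ 5))).add h1).congr_left fun x => ?_
    ring
  have hpow0 : ∀ k : ℕ, (fun x => m x ^ k - 1) =O[l₀] fun x => T x ^ 2 := by
    intro k
    refine (((hpow1 k).trans (hpow (by norm_num : 2 ≤ 4))).add
      (hηO.const_mul_left (k : ℂ))).congr_left fun x => ?_
    ring
  -- the coefficient of `m ^ n p²` in `S`, up to `O(T)`
  set q : ℂ → ℂ := fun x => p x / m x with hq
  have hqO : q =O[l₀] T := by
    have h1 : (fun x => (m x)⁻¹) =O[l₀] fun _ => (1 : ℂ) :=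
      (hm1.inv₀ one_ne_zero).isBigO_one ℂ
    have h2 := hpO.mul h1
    simp only [mul_one] at h2
    have h3 : (fun x => T x ^ 2) =O[l₀] T := by
      simpa using hpow (show 1 ≤ 2 by norm_num)
    exact (h2.trans h3).congr_left fun x => by rw [hq]; rfl
  have hq0 : Tendsto q l₀ (𝓝 0) := hqO.trans_tendsto hT
  have hpoly : ∀ R : ℂ[X], (fun x => R.eval (q x)) =O[l₀] (fun _ => (1 : ℂ)) ∧
      (fun x => R.eval (q x) - R.eval 0) =O[l₀] T := by
    intro R
    refine ⟨(R.continuous.continuousAt.tendsto.comp hq0).isBigO_one ℂ, ?_⟩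
    have h1 : (fun x => R.divX.eval (q x)) =O[l₀] fun _ => (1 : ℂ) :=
      (R.divX.continuous.continuousAt.tendsto.comp hq0).isBigO_one ℂ
    have h2 := h1.mul hqO
    simp only [one_mul] at h2
    refine h2.congr_left fun x => ?_
    conv_rhs => rw [← R.divX_mul_X_add]
    simp
  have hvO : v =O[l₀] T := by
    have h1 : (fun x => v x / (T x ^ 2 / a)) =O[l₀] fun _ => (1 : ℂ) := by
      refine ((hv.trans hTO).add (isBigO_const_const (a * σ) one_ne_zero l₀)).congr_left ?_
      intro x
      ring
    have h2 := h1.mul hpO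
    simp only [one_mul] at h2
    have h3 : (fun x => T x ^ 2) =O[l₀] T := by
      simpa using hpow (show 1 ≤ 2 by norm_num)
    refine (h2.trans h3).congr_left fun x => ?_
    rw [← hp, div_mul_cancel₀ _ (hp0 x)]
  have hJT : (fun x => J x * T x) =O[l₀] fun _ => (1 : ℂ) := by
    have h0 := (hJ.trans hTO).mul hTO
    simp only [mul_one] at h0
    have h1 := h0.add ((hTO.const_mul_left c₁).add (hx.const_mul_left (2 * a)))
    refine h1.congr_left fun x => ?_
    ring
  set B := P.eval 0 - 2 * u₀ * Q.eval 0 - φ * c₁ + 2 * φ * a * σ with hB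
  set G : ℂ → ℂ := fun x => P.eval (q x) - 2 * (u₀ + v x) * Q.eval (q x) +
    2 * φ * (v x / p x) * m x - φ * J x + J x * q x * Q.eval (q x) with hG
  have hGO : (fun x => G x - (B - 2 * a * φ * σ * x)) =O[l₀] T := by
    have h1 := (hpoly P).2
    have h2 := (hpoly Q).2.const_mul_left (2 * u₀)
    have h3 := (hvO.mul (hpoly Q).1).const_mul_left 2
    have h4 : (fun x => (v x / p x) * m x - a * σ) =O[l₀] T := by
      have h5 : (fun x => v x / p x - a * σ) =O[l₀] T := hv.congr_left fun x => by rw [hp]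
      have h6 := h5.mul (hm1.isBigO_one ℂ)
      have h7 := (((hpow0 1).trans (hpow (show 1 ≤ 2 by norm_num))).const_mul_left (a * σ))
      simp only [mul_one, pow_one] at h6 h7
      exact (h6.add h7).congr_left fun x => by ring
    have h5 := h4.const_mul_left (2 * φ)
    have h6 := hJ.const_mul_left φ
    have h7 : (fun x => J x * q x * Q.eval (q x)) =O[l₀] T := by
      have h8 : (fun x => (m x)⁻¹) =O[l₀] fun _ => (1 : ℂ) :=
        (hm1.inv₀ one_ne_zero).isBigO_one ℂ
      have h9 := (((hJT.mul (isBigO_refl T l₀)).mul h8).mul (hpoly Q).1).const_mul_left (1 / a)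
      simp only [mul_one, one_mul] at h9
      refine h9.congr_left fun x => ?_
      rw [hq]
      simp only [hp]
      field_simp
    simp only [mul_one] at h3
    refine (((((h1.sub h2).sub h3).add h5).sub h6).add h7).congr_left fun x => ?_
    simp only [hG, hB]
    ring
  have hBO : (fun x => (B - 2 * a * φ * σ * x) * T x) =O[l₀] fun _ => (1 : ℂ) := by
    refine ((hTO.const_mul_left B).sub (hx.const_mul_left (2 * a * φ))).congr_left fun x => ?_
    ring
  have hS : ∀ᶠ x in l₀, scaledRHS n P Q t φ u₀ (m x) (p x) (v x) (J x * p x ^ 2) =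
      m x ^ (n + 2) + (2 * u₀ * φ - t) * (m x ^ (n + 1) * p x) + m x ^ n * p x ^ 2 * G x := by
    filter_upwards [hm0] with x hx
    have := hp0 x
    simp only [scaledRHS, hG, hq]
    generalize P.eval (p x / m x) = P'
    generalize Q.eval (p x / m x) = Q'
    field_simp
    ring
  -- the remainder terms
  have e1 := hpow2 (n + 2)
  have e2 : (fun x => (2 * u₀ * φ - t) * ((m x ^ (n + 1) - (1 + ((n + 1 : ℕ) : ℂ) * η x)) * p x))
      =O[l₀] fun x => T x ^ 5 := by
    have h1 := (((hpow1 (n + 1)).mul hpO).const_mul_left (2 * u₀ * φ - t))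
    simp only [← pow_add] at h1
    exact h1.trans (hpow (by norm_num))
  have e3 : (fun x => (m x ^ n - 1) * p x ^ 2 * (B - 2 * a * φ * σ * x))
      =O[l₀] fun x => T x ^ 5 := by
    have h1 := (((hpow0 n).mul hBO).mul (isBigO_refl (fun x => T x ^ 3) l₀)).const_mul_left
      (1 / a ^ 2)
    simp only [mul_one, ← pow_add] at h1
    refine h1.congr_left fun x => ?_
    rw [hp]
    field_simp
  have e4 : (fun x => m x ^ n * p x ^ 2 * (G x - (B - 2 * a * φ * σ * x)))
      =O[l₀] fun x => T x ^ 5 := by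
    have h1 := (((hm1.pow n).isBigO_one ℂ).mul (hpO.pow 2)).mul hGO
    simp only [one_mul, ← pow_mul] at h1
    exact h1.congr_right fun x => by ring
  have e5 : (fun x => p x * w x) =O[l₀] fun x => T x ^ 5 := by
    have h1 := hpO.mul hwO
    simpa only [← pow_add] using h1
  have e6 : (fun x => w x ^ 2) =O[l₀] fun x => T x ^ 5 := by
    have h1 := hwO.pow 2
    simp only [← pow_mul] at h1
    exact h1.trans (hpow (by norm_num))
  have e7 : (fun x => (w x + n / 2 * l * p x ^ 2) ^ 2) =O[l₀] fun x => T x ^ 5 := by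
    have h1 := (hpO.pow 2).const_mul_left (n / 2 * l)
    simp only [← pow_mul] at h1
    have h2 := ((hwO.add (h1.trans (hpow (by norm_num : 3 ≤ 4)))).pow 2)
    simp only [← pow_mul] at h2
    exact h2.trans (hpow (by norm_num))
  have hsum := ((((e1.add e2).add e3).add e4).add ((e5.const_mul_left
    ((n + 2) * (n + 1) * b + (n + 1) * (2 * u₀ * φ - t))).add
      (e6.const_mul_left ((n + 2) * (n + 1) / 2)))).sub e7
  refine hsum.congr' ?_ EventuallyEq.rfl
  filter_upwards [hS] with x hSx
  rw [hSx]
  simp only [hη, hw]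
  push_cast
  linear_combination (-p x) * hb + (-p x ^ 2) * hc + (-p x ^ 2 * x * a * φ / 3) * hσ +
    (-n * p x ^ 2) * hl + (- x * p x ^ 2 * (n + 4)) * hl
end Residual

/-! ### Singular solutions -/

section SingularSolutions

open Polynomial

/-- The residual of the ansatz in the equation `m' = (2 / n) (m - √S)`, solved for `m'`. -/
theorem scaledField_ansatz_isBigO {n : ℕ} (hn : n ≠ 0) (P Q : ℂ[X]) {t φ u₀ a b c c₁ σ : ℂ}
    (ha : a ≠ 0) (hσ : n * σ = 2 * σ) (hb : (n + 2) * b = t - 2 * u₀ * φ)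
    (hc : (n + 4) * c + n * (a * φ / 3 * σ) + (n + 2) * (n + 1) / 2 * b ^ 2 +
      (n + 1) * (2 * u₀ * φ - t) * b + (P.eval 0 - 2 * u₀ * Q.eval 0 - φ * c₁ + 2 * φ * a * σ) = 0)
    {l₀ : Filter ℂ} {T v J : ℂ → ℂ} (hT : Tendsto T l₀ (𝓝 0)) (hT0 : ∀ x, T x ≠ 0)
    (hx : (fun x => σ * x * T x) =O[l₀] fun _ => (1 : ℂ))
    (hv : (fun x => v x / (T x ^ 2 / a) - a * σ) =O[l₀] T)
    (hJ : (fun x => J x - (c₁ + 2 * a * σ * x)) =O[l₀] T)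
    {p m m' : ℂ → ℂ} (hp : ∀ x, p x = T x ^ 2 / a)
    (hm : ∀ x, m x = 1 + b * p x + (c + a * φ / 3 * σ * x) * p x ^ 2)
    (hm' : ∀ x, m' x = 2 / n * (b * p x) + 4 / n * ((c + a * φ / 3 * σ * x) * p x ^ 2) +
      a * φ / 3 * σ * p x ^ 2) :
    (fun x => scaledField n P Q t φ u₀ (m x, p x, v x, J x * p x ^ 2) - m x - m' x)
      =O[l₀] fun x => T x ^ 5 := by
  have hn' : (n : ℂ) ≠ 0 := Nat.cast_ne_zero.2 hn
  have key := scaledRHS_ansatz_isBigO P Q ha hσ hb hc hT hT0 hx hv hJ hp hm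
  set S : ℂ → ℂ := fun x => scaledRHS n P Q t φ u₀ (m x) (p x) (v x) (J x * p x ^ 2) with hS
  set r : ℂ → ℂ := fun x => 1 - (c + a * φ / 3 * σ * x) * p x ^ 2 -
    n / 2 * (a * φ / 3 * σ) * p x ^ 2 with hr
  have hp0 : Tendsto p l₀ (𝓝 0) := by
    have h1 := (hT.pow 2).div_const a
    simp only [ne_eq, OfNat.ofNat_ne_zero, not_false_eq_true, zero_pow, zero_div] at h1
    exact h1.congr fun x => (hp x).symm
  have hr1 : Tendsto r l₀ (𝓝 1) := by
    have h1 : Tendsto (fun x => (c + a * φ / 3 * σ * x) * p x ^ 2) l₀ (𝓝 0) := by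
      have h2 := (add_mul_sq_isBigO c (a * φ / 3) a hT hx).trans_tendsto
        (by simpa using hT.pow 3)
      exact h2.congr fun x => by rw [hp]
    have h3 := (h1.const_sub 1).sub ((hp0.pow 2).const_mul (n / 2 * (a * φ / 3 * σ)))
    simpa using h3
  have hS1 : Tendsto S l₀ (𝓝 1) := by
    have h1 : Tendsto (fun x => S x - r x ^ 2) l₀ (𝓝 0) :=
      key.trans_tendsto (by simpa using hT.pow 5)
    simpa using h1.add (hr1.pow 2)
  have hsq : Tendsto (fun x => S x ^ (1 / 2 : ℂ)) l₀ (𝓝 1) := by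
    have h1 : ContinuousAt (fun z : ℂ => z ^ (1 / 2 : ℂ)) 1 :=
      continuousAt_id.cpow continuousAt_const Complex.one_mem_slitPlane
    simpa [Function.comp_def] using h1.tendsto.comp hS1
  have hsum : Tendsto (fun x => r x + S x ^ (1 / 2 : ℂ)) l₀ (𝓝 (1 + 1)) := hr1.add hsq
  have hinv : (fun x => (r x + S x ^ (1 / 2 : ℂ))⁻¹) =O[l₀] fun _ => (1 : ℂ) :=
    (hsum.inv₀ (by norm_num)).isBigO_one ℂ
  have h1 := ((key.mul hinv).const_mul_left (-(2 / n)))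
  simp only [mul_one] at h1
  refine h1.congr' ?_ EventuallyEq.rfl
  filter_upwards [hsum.eventually_ne (by norm_num : (1 + 1 : ℂ) ≠ 0)] with x hx0
  have hS2 : (S x ^ (1 / 2 : ℂ)) ^ 2 = S x := by
    rw [← Complex.cpow_nat_mul]
    norm_num
  have h2 : (S x - r x ^ 2) * (r x + S x ^ (1 / 2 : ℂ))⁻¹ = S x ^ (1 / 2 : ℂ) - r x := by
    rw [← div_eq_mul_inv, div_eq_iff hx0]
    linear_combination -hS2
  change -(2 / (n : ℂ)) * ((S x - r x ^ 2) * (r x + S x ^ (1 / 2 : ℂ))⁻¹) =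
    m x + 2 / n * (m x - S x ^ (1 / 2 : ℂ)) - m x - m' x
  rw [h2, hm', hm]
  simp only [hr]
  field_simp
  ring

/-- The filter of the neighbourhoods of the left end of `Ω₀`, where `exp (x / n)` tends to `0`. -/
noncomputable def leftEnd (n : ℕ) (Ω₀ : Set ℂ) : Filter ℂ :=
  comap (fun x : ℂ => ‖Complex.exp (x / n)‖) (𝓝 0) ⊓ 𝓟 Ω₀

theorem eventually_leftEnd {n : ℕ} {Ω₀ : Set ℂ} {p : ℂ → Prop} :
    (∀ᶠ x in leftEnd n Ω₀, p x) ↔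
      ∃ R : ℝ, 0 < R ∧ ∀ x ∈ Ω₀, ‖Complex.exp (x / n)‖ < R → p x := by
  rw [leftEnd, eventually_inf_principal, eventually_comap, Metric.eventually_nhds_iff]
  constructor
  · rintro ⟨R, hR, h⟩
    exact ⟨R, hR, fun x hx hxR => h (by simpa using hxR) x rfl hx⟩
  · rintro ⟨R, hR, h⟩
    refine ⟨R, hR, fun y hy x hxy hx => h x hx ?_⟩
    subst hxy
    simpa using hy

theorem tendsto_exp_leftEnd (n : ℕ) (Ω₀ : Set ℂ) :
    Tendsto (fun x : ℂ => Complex.exp (x / n)) (leftEnd n Ω₀) (𝓝 0) :=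
  tendsto_zero_iff_norm_tendsto_zero.2 (tendsto_comap.mono_left inf_le_left)

/-- The part of `Ω₀` where `|exp (x / n)| < R`. -/
def leftPart (n : ℕ) (Ω₀ : Set ℂ) (R : ℝ) : Set ℂ := {x | x ∈ Ω₀ ∧ ‖Complex.exp (x / n)‖ < R}

theorem isOpen_leftPart {n : ℕ} {Ω₀ : Set ℂ} (h : IsOpen Ω₀) (R : ℝ) :
    IsOpen (leftPart n Ω₀ R) := by
  have h1 : IsOpen {x : ℂ | ‖Complex.exp (x / n)‖ < R} := isOpen_lt (by fun_prop) continuous_const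
  exact h.inter h1

theorem norm_exp_div (n : ℕ) (x : ℂ) : ‖Complex.exp (x / n)‖ = Real.exp (x.re / n) := by
  rw [Complex.norm_exp, Complex.div_natCast_re]

theorem leftInvariant_leftPart {n : ℕ} {Ω₀ : Set ℂ} (h : LeftInvariant Ω₀) (R : ℝ) :
    LeftInvariant (leftPart n Ω₀ R) := by
  refine fun x hx s hs => ⟨h x hx.1 s hs, lt_of_le_of_lt ?_ hx.2⟩
  rw [norm_exp_div, norm_exp_div]
  refine Real.exp_le_exp.2 (div_le_div_of_nonneg_right ?_ n.cast_nonneg)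
  simpa using hs

theorem hasDerivAt_exp_div (n : ℕ) (x : ℂ) :
    HasDerivAt (fun x : ℂ => Complex.exp (x / n)) (Complex.exp (x / n) / n) x := by
  refine ((hasDerivAt_id x).div_const (n : ℂ)).cexp.congr_deriv ?_
  simp
  rfl

/-- An approximate solution of the scaled system with residual `O(exp (5 x / n))` is corrected to
an exact solution. The unknowns of the fixed point problem are the two corrections, multiplied by
`exp x`, which turns the characteristic exponent `-1` into `0`. -/
theorem exists_scaled_solution {n : ℕ} (hn : 2 ≤ n) (P Q : ℂ[X]) {t φ u₀ a : ℂ} (hφ : φ ≠ 0)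
    (ha : a ≠ 0) {Ω₀ : Set ℂ} (hΩo : IsOpen Ω₀) (hΩ : LeftInvariant Ω₀) {m₀ m₀' J₀ : ℂ → ℂ}
    (hm₀ : ∀ x, HasDerivAt m₀ (m₀' x) x)
    (hJ₀ : ∀ x, HasDerivAt J₀ (2 * a * Complex.exp (x / n) ^ (n - 2) * m₀ x) x)
    (hm1 : Tendsto m₀ (leftEnd n Ω₀) (𝓝 1))
    (hJ1 : Tendsto (fun x => J₀ x * (Complex.exp (x / n) ^ 2 / a) ^ 2) (leftEnd n Ω₀) (𝓝 0))
    (hres : (fun x => scaledField n P Q t φ u₀ (m₀ x, Complex.exp (x / n) ^ 2 / a,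
        Complex.exp (x / n) ^ n, J₀ x * (Complex.exp (x / n) ^ 2 / a) ^ 2) - m₀ x - m₀' x)
      =O[leftEnd n Ω₀] fun x => Complex.exp (x / n) ^ 5) :
    ∃ R : ℝ, 0 < R ∧ ∃ m J : ℂ → ℂ, ∃ C : ℝ,
      (∀ x ∈ leftPart n Ω₀ R, ‖m x - m₀ x‖ ≤ C * ‖Complex.exp (x / n)‖ ^ 5 ∧
        m x ≠ 0 ∧
        scaledRHS n P Q t φ u₀ (m x) (Complex.exp (x / n) ^ 2 / a) (Complex.exp (x / n) ^ n)
          (J x * (Complex.exp (x / n) ^ 2 / a) ^ 2) ∈ Complex.slitPlane ∧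
        -φ + Q.eval (Complex.exp (x / n) ^ 2 / a / m x) * (Complex.exp (x / n) ^ 2 / a / m x) ≠ 0 ∧
        HasDerivAt m (2 / n * (m x - scaledRHS n P Q t φ u₀ (m x) (Complex.exp (x / n) ^ 2 / a)
          (Complex.exp (x / n) ^ n)
          (J x * (Complex.exp (x / n) ^ 2 / a) ^ 2) ^ (1 / 2 : ℂ))) x ∧
        HasDerivAt J (2 * a * Complex.exp (x / n) ^ (n - 2) * m x) x) ∧
      ∀ p : ℂ, (∀ x ∈ Ω₀, x + p ∈ Ω₀) → Complex.exp (p / n) = 1 → (∀ x, m₀ (x + p) = m₀ x) →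
        (∀ x, J₀ (x + p) = J₀ x) → ∀ x ∈ leftPart n Ω₀ R, m (x + p) = m x := by
  have hnC : (n : ℂ) ≠ 0 := Nat.cast_ne_zero.2 (by omega)
  have hnR : (0 : ℝ) < n := Nat.cast_pos.2 (by omega)
  set T : ℂ → ℂ := fun x => Complex.exp (x / n) with hTdef
  have hT : Tendsto T (leftEnd n Ω₀) (𝓝 0) := tendsto_exp_leftEnd n Ω₀
  have hTn : ∀ x, T x ^ n = Complex.exp x := fun x => by
    rw [hTdef, ← Complex.exp_nat_mul]
    congr 1
    field_simp
  have hTd : Differentiable ℂ T := fun x => (hasDerivAt_exp_div n x).differentiableAt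
  set ε : ℝ := 1 / n with hε
  have hε0 : 0 < ε := by positivity
  obtain ⟨r, C, hr, hC, hnear, hlip⟩ :=
    exists_scaledField_lipschitz n P Q t φ u₀ (by omega) hφ hε0
  obtain ⟨C₀, hC₀, hres'⟩ := hres.exists_pos
  rw [isBigOWith_iff] at hres'
  -- With `J = J₀ + L κ`, the equation `κ' = (2 a / L) exp ((n - 2) x / n) (m - m₀)` has Lipschitz
  -- constant `2 ε`; the radius `ρ` solves `C₀ + (1 + 2 ε) ρ = (1 + 5 ε) ρ`.
  set L : ℝ := ‖a‖ / ε with hL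
  have hL0 : 0 < L := by positivity
  set ρ : ℝ := C₀ / (3 * ε) with hρ
  have hρ0 : 0 < ρ := by positivity
  -- smallness conditions near the end
  have hT5 : Tendsto (fun x => ‖T x‖ ^ 5) (leftEnd n Ω₀) (𝓝 0) := by
    simpa using hT.norm.pow 5
  have hp0 : Tendsto (fun x => T x ^ 2 / a) (leftEnd n Ω₀) (𝓝 0) := by
    simpa using (hT.pow 2).div_const a
  have hpn : Tendsto (fun x => ‖T x ^ 2 / a‖ ^ 2) (leftEnd n Ω₀) (𝓝 0) := by
    simpa using hp0.norm.pow 2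
  have hv0 : Tendsto (fun x => T x ^ n) (leftEnd n Ω₀) (𝓝 0) := by
    simpa [show n ≠ 0 by omega] using hT.pow n
  have c1 : ∀ᶠ x in leftEnd n Ω₀, ‖m₀ x - 1‖ < r / 2 := by
    have h1 : Tendsto (fun x => ‖m₀ x - 1‖) (leftEnd n Ω₀) (𝓝 0) := by
      simpa using (hm1.sub_const 1).norm
    exact h1.eventually_lt_const (by positivity)
  have c2 : ∀ᶠ x in leftEnd n Ω₀, ‖J₀ x * (T x ^ 2 / a) ^ 2‖ < r / 2 := by
    have h1 := hJ1.norm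
    rw [norm_zero] at h1
    exact h1.eventually_lt_const (by positivity)
  have c3 : ∀ᶠ x in leftEnd n Ω₀, ρ * ‖T x‖ ^ 5 < r / 2 := by
    have h1 := hT5.const_mul ρ
    rw [mul_zero] at h1
    exact h1.eventually_lt_const (by positivity)
  have c4 : ∀ᶠ x in leftEnd n Ω₀, L * (ρ * ‖T x‖ ^ 5) * ‖T x ^ 2 / a‖ ^ 2 < r / 2 := by
    have h1 := ((hT5.const_mul ρ).const_mul L).mul hpn
    simp only [mul_zero] at h1
    exact h1.eventually_lt_const (by positivity)
  have c5 : ∀ᶠ x in leftEnd n Ω₀, ‖T x ^ 2 / a‖ < r := by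
    have h1 := hp0.norm
    rw [norm_zero] at h1
    exact h1.eventually_lt_const hr
  have c6 : ∀ᶠ x in leftEnd n Ω₀, ‖T x ^ n‖ < r := by
    have h1 := hv0.norm
    rw [norm_zero] at h1
    exact h1.eventually_lt_const hr
  have c7 : ∀ᶠ x in leftEnd n Ω₀, C * L * ‖T x ^ 2 / a‖ ^ 2 < ε := by
    have h1 := hpn.const_mul (C * L)
    rw [mul_zero] at h1
    exact h1.eventually_lt_const hε0
  have c8 : ∀ᶠ x in leftEnd n Ω₀, ‖T x‖ < 1 := by
    have h1 := hT.norm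
    rw [norm_zero] at h1
    exact h1.eventually_lt_const one_pos
  obtain ⟨R, hR, hall⟩ := eventually_leftEnd.1
    (c1.and (c2.and (c3.and (c4.and (c5.and (c6.and (c7.and (c8.and hres'))))))))
  set Ω := leftPart n Ω₀ R with hΩdef
  have hΩR : ∀ x ∈ Ω, ‖m₀ x - 1‖ < r / 2 ∧ ‖J₀ x * (T x ^ 2 / a) ^ 2‖ < r / 2 ∧
      ρ * ‖T x‖ ^ 5 < r / 2 ∧ L * (ρ * ‖T x‖ ^ 5) * ‖T x ^ 2 / a‖ ^ 2 < r / 2 ∧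
      ‖T x ^ 2 / a‖ < r ∧ ‖T x ^ n‖ < r ∧ C * L * ‖T x ^ 2 / a‖ ^ 2 < ε ∧ ‖T x‖ < 1 ∧
      ‖scaledField n P Q t φ u₀ (m₀ x, T x ^ 2 / a, T x ^ n, J₀ x * (T x ^ 2 / a) ^ 2) - m₀ x -
        m₀' x‖ ≤ C₀ * ‖T x ^ 5‖ := fun x hx => hall x hx.1 hx.2
  have hΩo' : IsOpen Ω := isOpen_leftPart hΩo R
  have hΩ' : LeftInvariant Ω := leftInvariant_leftPart hΩ R
  -- the weight `|exp x| |exp (x / n)| ^ 5`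
  set δ : ℝ := 1 + 5 * ε with hδ
  have hweight : ∀ x : ℂ, Real.exp (δ * x.re) = ‖Complex.exp x‖ * ‖T x‖ ^ 5 := by
    intro x
    rw [Complex.norm_exp, hTdef]
    simp only
    rw [norm_exp_div, ← Real.exp_nat_mul, ← Real.exp_add, hδ, hε]
    congr 1
    push_cast
    ring
  -- the corrected functions
  set M : ℂ → ℂ × ℂ → ℂ := fun x U => m₀ x + Complex.exp (-x) * U.1 with hM
  set I : ℂ → ℂ × ℂ → ℂ := fun x U => J₀ x + L * (Complex.exp (-x) * U.2) with hI
  set arg : ℂ → ℂ × ℂ → ℂ × ℂ × ℂ × ℂ := fun x U =>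
    (M x U, T x ^ 2 / a, T x ^ n, I x U * (T x ^ 2 / a) ^ 2) with harg
  set Φ : ℂ → ℂ × ℂ → ℂ × ℂ := fun x U =>
    (Complex.exp x * (scaledField n P Q t φ u₀ (arg x U) - m₀ x - m₀' x),
      U.2 + 2 * a / L * T x ^ (n - 2) * U.1) with hΦ
  have hexp : ∀ x : ℂ, ‖Complex.exp (-x)‖ * ‖Complex.exp x‖ = 1 := fun x => by
    rw [← norm_mul, ← Complex.exp_add]
    simp
  have hsmall : ∀ x, ∀ z : ℂ, ‖z‖ ≤ ρ * Real.exp (δ * x.re) →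
      ‖Complex.exp (-x) * z‖ ≤ ρ * ‖T x‖ ^ 5 := by
    intro x z hz
    rw [norm_mul]
    refine (mul_le_mul_of_nonneg_left hz (norm_nonneg _)).trans_eq ?_
    rw [hweight]
    linear_combination (ρ * ‖T x‖ ^ 5) * hexp x
  have hball : ∀ x ∈ Ω, ∀ U : ℂ × ℂ, ‖U‖ ≤ ρ * Real.exp (δ * x.re) →
      ‖M x U - 1‖ < r ∧ ‖I x U * (T x ^ 2 / a) ^ 2‖ < r := by
    intro x hx U hU
    obtain ⟨h1, h2, h3, h4, -⟩ := hΩR x hx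
    have h5 := hsmall x U.1 ((norm_fst_le U).trans hU)
    have h6 := hsmall x U.2 ((norm_snd_le U).trans hU)
    constructor
    · have h7 : M x U - 1 = (m₀ x - 1) + Complex.exp (-x) * U.1 := by rw [hM]; ring
      rw [h7]
      linarith [norm_add_le (m₀ x - 1) (Complex.exp (-x) * U.1)]
    · have h7 : I x U * (T x ^ 2 / a) ^ 2 = J₀ x * (T x ^ 2 / a) ^ 2 +
          L * (Complex.exp (-x) * U.2) * (T x ^ 2 / a) ^ 2 := by rw [hI]; ring
      have h8 : ‖L * (Complex.exp (-x) * U.2) * (T x ^ 2 / a) ^ 2‖ ≤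
          L * (ρ * ‖T x‖ ^ 5) * ‖T x ^ 2 / a‖ ^ 2 := by
        rw [norm_mul, norm_mul, norm_pow, Complex.norm_real, Real.norm_of_nonneg hL0.le]
        gcongr
      rw [h7]
      linarith [norm_add_le (J₀ x * (T x ^ 2 / a) ^ 2)
        (L * (Complex.exp (-x) * U.2) * (T x ^ 2 / a) ^ 2)]
  have hgood : ∀ x ∈ Ω, ∀ U : ℂ × ℂ, ‖U‖ ≤ ρ * Real.exp (δ * x.re) → M x U ≠ 0 ∧
      scaledRHS n P Q t φ u₀ (M x U) (T x ^ 2 / a) (T x ^ n) (I x U * (T x ^ 2 / a) ^ 2) ∈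
        Complex.slitPlane ∧
      -φ + Q.eval (T x ^ 2 / a / M x U) * (T x ^ 2 / a / M x U) ≠ 0 := by
    intro x hx U hU
    obtain ⟨h1, h2⟩ := hball x hx U hU
    obtain ⟨-, -, -, -, h3, h4, -⟩ := hΩR x hx
    exact hnear _ _ _ _ h1 h3 h4 h2
  have hm₀d : Differentiable ℂ m₀ := fun x => (hm₀ x).differentiableAt
  have hm₀'d : Differentiable ℂ m₀' := by
    have h1 : deriv m₀ = m₀' := funext fun x => (hm₀ x).deriv
    rw [← h1]
    exact differentiableOn_univ.1 (hm₀d.differentiableOn.deriv isOpen_univ)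
  have hJ₀d : Differentiable ℂ J₀ := fun x => (hJ₀ x).differentiableAt
  obtain ⟨U, hUb, hUd, hUp⟩ := exists_solution_of_lipschitz hΩo' hΩ' (δ := δ)
    (k := 1 + 2 * ε) (C := C₀) (r := ρ) (Φ := Φ) (by positivity) (by rw [hδ]; linarith)
    (by
      rw [hδ, hρ]
      apply le_of_eq
      field_simp
      ring) hC₀.le
    (by
      intro x hx
      obtain ⟨-, -, -, -, -, -, -, -, h1⟩ := hΩR x hx
      have h2 : Φ x 0 = (Complex.exp x * (scaledField n P Q t φ u₀
          (m₀ x, T x ^ 2 / a, T x ^ n, J₀ x * (T x ^ 2 / a) ^ 2) - m₀ x - m₀' x), 0) := by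
        simp [hΦ, harg, hM, hI]
      rw [h2, Prod.norm_mk, norm_zero, max_eq_left (norm_nonneg _), norm_mul, hweight]
      rw [norm_pow] at h1
      refine (mul_le_mul_of_nonneg_left h1 (norm_nonneg _)).trans_eq (by ring))
    (by
      intro x hx U V hU hV
      obtain ⟨-, -, -, -, h3, h4, h5, h6, -⟩ := hΩR x hx
      obtain ⟨h1, h2⟩ := hball x hx U hU
      obtain ⟨h1', h2'⟩ := hball x hx V hV
      have h7 := hlip _ _ _ _ _ _ h1 h1' h3 h4 h2 h2'
      have h8 := norm_fst_le (U - V)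
      have h9 := norm_snd_le (U - V)
      rw [Prod.fst_sub] at h8
      rw [Prod.snd_sub] at h9
      have h10 : ‖M x U - M x V‖ = ‖Complex.exp (-x)‖ * ‖U.1 - V.1‖ := by
        rw [← norm_mul]
        congr 1
        rw [hM]
        ring
      have h11 : ‖I x U * (T x ^ 2 / a) ^ 2 - I x V * (T x ^ 2 / a) ^ 2‖ =
          ‖Complex.exp (-x)‖ * (L * ‖T x ^ 2 / a‖ ^ 2 * ‖U.2 - V.2‖) := by
        have h12 : I x U * (T x ^ 2 / a) ^ 2 - I x V * (T x ^ 2 / a) ^ 2 =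
            Complex.exp (-x) * (L * (T x ^ 2 / a) ^ 2 * (U.2 - V.2)) := by
          rw [hI]
          ring
        rw [h12, norm_mul, norm_mul, norm_mul, norm_pow, Complex.norm_real,
          Real.norm_of_nonneg hL0.le]
      rw [Prod.norm_def, max_le_iff]
      constructor
      · have h12 : (Φ x U - Φ x V).1 = Complex.exp x * (scaledField n P Q t φ u₀ (arg x U) -
            scaledField n P Q t φ u₀ (arg x V)) := by
          simp only [hΦ, Prod.fst_sub]
          ring
        rw [h12, norm_mul]
        rw [h10, h11] at h7
        have h13 := mul_le_mul_of_nonneg_left h7 (norm_nonneg (Complex.exp x))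
        have h14 : ‖Complex.exp x‖ * (ε * (‖Complex.exp (-x)‖ * ‖U.1 - V.1‖) +
            C * (‖Complex.exp (-x)‖ * (L * ‖T x ^ 2 / a‖ ^ 2 * ‖U.2 - V.2‖))) =
            ε * ‖U.1 - V.1‖ + C * L * ‖T x ^ 2 / a‖ ^ 2 * ‖U.2 - V.2‖ := by
          linear_combination (ε * ‖U.1 - V.1‖ +
            C * L * ‖T x ^ 2 / a‖ ^ 2 * ‖U.2 - V.2‖) * hexp x
        rw [h14] at h13
        refine h13.trans ?_
        have h15 := mul_le_mul_of_nonneg_left h8 hε0.le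
        have h16 := mul_le_mul h5.le h9 (norm_nonneg _) hε0.le
        have := norm_nonneg (U - V)
        linarith
      · have h12 : (Φ x U - Φ x V).2 =
            (U.2 - V.2) + 2 * a / L * T x ^ (n - 2) * (U.1 - V.1) := by
          simp only [hΦ, Prod.snd_sub]
          ring
        have h13 : ‖2 * a / L * T x ^ (n - 2) * (U.1 - V.1)‖ ≤ 2 * ε * ‖U.1 - V.1‖ := by
          rw [norm_mul, norm_mul, norm_div, norm_mul, norm_pow, Complex.norm_real,
            Real.norm_of_nonneg hL0.le, Complex.norm_two]
          have h14 : 2 * ‖a‖ / L = 2 * ε := by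
            rw [hL]
            have : ‖a‖ ≠ 0 := norm_ne_zero_iff.2 ha
            field_simp
          rw [h14]
          have h15 : ‖T x‖ ^ (n - 2) ≤ 1 := pow_le_one₀ (norm_nonneg _) h6.le
          have h16 : 2 * ε * ‖T x‖ ^ (n - 2) ≤ 2 * ε * 1 := by gcongr
          rw [mul_one] at h16
          gcongr
        rw [h12]
        have h14 := norm_add_le (U.2 - V.2) (2 * a / L * T x ^ (n - 2) * (U.1 - V.1))
        have h15 := mul_le_mul_of_nonneg_left h8 hε0.le
        linarith)
    (by
      intro U hU hUb x hx
      have h1 : DifferentiableAt ℂ U x := hU.differentiableAt (hΩo'.mem_nhds hx)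
      obtain ⟨h2, h3, -⟩ := hgood x hx (U x) (hUb x hx)
      have h4 := (analyticAt_scaledField n P Q t φ u₀ (z := arg x (U x)) h2 h3).differentiableAt
      have h5 : DifferentiableAt ℂ (fun x => arg x (U x)) x := by
        have := h1.fst
        have := h1.snd
        simp only [harg, hM, hI]
        fun_prop
      have h6 := h4.comp x h5
      have h7 : DifferentiableAt ℂ (fun x => scaledField n P Q t φ u₀ (arg x (U x))) x := h6
      have := h1.fst
      have := h1.snd
      refine DifferentiableAt.differentiableWithinAt ?_
      simp only [hΦ]
      fun_prop)
  refine ⟨R, hR, fun x => M x (U x), fun x => I x (U x), ρ, fun x hx => ?_,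
    fun p hpΩ hp hmp hJp x hx => ?_⟩
  · obtain ⟨h1, h2, h3⟩ := hgood x hx (U x) (hUb x hx)
    have hU1 := (hUd x hx).fst
    have hU2 := (hUd x hx).snd
    have he : HasDerivAt (fun x : ℂ => Complex.exp (-x)) (-Complex.exp (-x)) x := by
      simpa using (hasDerivAt_neg x).cexp
    have hee : Complex.exp (-x) * Complex.exp x = 1 := by
      rw [← Complex.exp_add]
      simp
    refine ⟨?_, h1, h2, h3, ?_, ?_⟩
    · have h4 : M x (U x) - m₀ x = Complex.exp (-x) * (U x).1 := by rw [hM]; ring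
      rw [h4]
      exact hsmall x _ ((norm_fst_le _).trans (hUb x hx))
    · refine ((hm₀ x).add (he.mul hU1)).congr_deriv ?_
      have h4 : scaledField n P Q t φ u₀ (arg x (U x)) = M x (U x) + 2 / n * (M x (U x) -
        scaledRHS n P Q t φ u₀ (M x (U x)) (T x ^ 2 / a) (T x ^ n)
          (I x (U x) * (T x ^ 2 / a) ^ 2) ^ (1 / 2 : ℂ)) := rfl
      have h5 : M x (U x) = m₀ x + Complex.exp (-x) * (U x).1 := rfl
      have h6 : (Φ x (U x)).1 = Complex.exp x *
        (scaledField n P Q t φ u₀ (arg x (U x)) - m₀ x - m₀' x) := rfl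
      rw [h6]
      linear_combination h4 + h5 +
        (scaledField n P Q t φ u₀ (arg x (U x)) - m₀ x - m₀' x) * hee
    · refine ((hJ₀ x).add ((he.mul hU2).const_mul (L : ℂ))).congr_deriv ?_
      have h6 : (Φ x (U x)).2 = (U x).2 + 2 * a / L * T x ^ (n - 2) * (U x).1 := rfl
      have h7 : (L : ℂ) ≠ 0 := Complex.ofReal_ne_zero.2 hL0.ne'
      rw [h6]
      simp only [hM, hTdef]
      field_simp
      ring
  · have hTp : ∀ x, T (x + p) = T x := fun x => by
      rw [hTdef]
      simp only
      rw [add_div, Complex.exp_add, hp, mul_one]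
    have hep : Complex.exp p = 1 := by
      have h1 := hTn p
      have h2 : T p = 1 := hp
      rw [h2, one_pow] at h1
      exact h1.symm
    have hexpp : ∀ x : ℂ, Complex.exp (x + p) = Complex.exp x := fun x => by
      rw [Complex.exp_add, hep, mul_one]
    have hexpn : ∀ x : ℂ, Complex.exp (-(x + p)) = Complex.exp (-x) := fun x => by
      rw [Complex.exp_neg, hexpp, Complex.exp_neg]
    have hm₀'p : ∀ x, m₀' (x + p) = m₀' x := by
      intro x
      have h1 := (hm₀ (x + p)).comp_add_const x p
      rw [show (fun x => m₀ (x + p)) = m₀ from funext hmp] at h1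
      exact h1.unique (hm₀ x)
    have h1 := hUp p (fun y hy => ⟨hpΩ y hy.1, by
        have : Complex.exp ((y + p) / n) = Complex.exp (y / n) := hTp y
        rw [this]
        exact hy.2⟩)
      (fun y V => by simp only [hΦ, harg, hM, hI, hTp, hexpp, hexpn, hmp, hJp, hm₀'p]) x hx
    simp only [hM]
    rw [h1, hexpn, hmp]

/-- A solution of the scaled system gives a multivalued solution of the reduced equation, via the
system `Y' + 2 u Z' = 0`, `det N = 4 ζ (Z')²` with `Y = J - 2 u Z`. -/
theorem isMultivaluedSolution_of_scaled {n : ℕ} (K : QuadricConstants n) (hn : 2 ≤ n) {ζ : ℂ}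
    (hζ : ζ ≠ 0) {a u₀ : ℂ} (ha0 : a ≠ 0) (ha : (-2) ^ n * (n : ℂ) ^ 2 * a ^ n = -16 * ζ)
    {P Q : ℂ[X]}
    (hP : ∀ Z : ℂ, Z ≠ 0 → K.E Z = -(-2) ^ n * Z ^ (n + 2) *
      (1 - K.X₀.trace / 2 * Z⁻¹ + P.eval Z⁻¹ * Z⁻¹ ^ 2))
    (hQ : ∀ Z : ℂ, Z ≠ 0 → K.D Z = -(-2) ^ n * Z ^ n * (-K.φ + Q.eval Z⁻¹ * Z⁻¹))
    {Ω : Set ℂ} {m J : ℂ → ℂ} {S : ℂ → ℂ}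
    (hS : ∀ x, S x = scaledRHS n P Q (K.X₀.trace / 2) K.φ u₀ (m x) (Complex.exp (x / n) ^ 2 / a)
      (Complex.exp (x / n) ^ n) (J x * (Complex.exp (x / n) ^ 2 / a) ^ 2))
    (h : ∀ x ∈ Ω, m x ≠ 0 ∧ S x ∈ Complex.slitPlane ∧
      -K.φ + Q.eval (Complex.exp (x / n) ^ 2 / a / m x) *
        (Complex.exp (x / n) ^ 2 / a / m x) ≠ 0 ∧
      HasDerivAt m (2 / n * (m x - S x ^ (1 / 2 : ℂ))) x ∧
      HasDerivAt J (2 * a * Complex.exp (x / n) ^ (n - 2) * m x) x) :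
    IsMultivaluedSolution (K.IsReducedSolution ζ 1) u₀ Ω
      (fun x => Complex.exp (-2 * x / n) * (a * m x)) := by
  have hn0 : (n : ℂ) ≠ 0 := Nat.cast_ne_zero.2 (by omega)
  intro V L hV hL hLΩ
  set T : ℂ → ℂ := fun x => Complex.exp (x / n) with hT
  have hT0 : ∀ x, T x ≠ 0 := fun x => Complex.exp_ne_zero _
  have hTn : ∀ x, T x ^ n = Complex.exp x := fun x => by
    rw [hT, ← Complex.exp_nat_mul]
    congr 1
    field_simp
  have hTn2 : ∀ x, T x ^ (n - 2) = Complex.exp x / T x ^ 2 := fun x => by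
    rw [eq_div_iff (pow_ne_zero _ (hT0 x)), ← pow_add, Nat.sub_add_cancel hn, hTn]
  set F : ℂ → ℂ := fun x => Complex.exp (-2 * x / n) * (a * m x) with hF
  have hexp2 : ∀ x : ℂ, Complex.exp (-2 * x / n) = (T x ^ 2)⁻¹ := fun x => by
    rw [hT, ← Complex.exp_nat_mul, ← Complex.exp_neg]
    congr 1
    push_cast
    ring
  have hFx : ∀ x, F x = a * m x / T x ^ 2 := fun x => by
    rw [hF]
    simp only [hexp2]
    ring
  set r : ℂ → ℂ := fun x => S x ^ (1 / 2 : ℂ) with hr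
  have hFd : ∀ x ∈ Ω, HasDerivAt F (-(2 / n) * (a / T x ^ 2) * r x) x := by
    intro x hx
    obtain ⟨-, -, -, h4, -⟩ := h x hx
    have h5 : HasDerivAt (fun x : ℂ => Complex.exp (-2 * x / n))
        (Complex.exp (-2 * x / n) * (-2 / n)) x := by
      have := (((hasDerivAt_id x).const_mul (-2 : ℂ)).div_const (n : ℂ)).cexp
      simpa using! this
    refine (h5.mul (h4.const_mul a)).congr_deriv ?_
    rw [hexp2]
    ring
  have hu : ∀ u ∈ V, u - u₀ ≠ 0 := fun u hu => by
    rw [← (hLΩ u hu).2]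
    exact Complex.exp_ne_zero _
  have hLd : ∀ u ∈ V, HasDerivAt L (1 / (u - u₀)) u := by
    intro u huV
    have h1 := (hL.differentiableAt (hV.mem_nhds huV)).hasDerivAt
    have h2 : HasDerivAt (fun u => u - u₀) (Complex.exp (L u) * deriv L u) u := by
      refine h1.cexp.congr_of_eventuallyEq ?_
      filter_upwards [hV.mem_nhds huV] with w hw using (hLΩ w hw).2.symm
    have h3 := h2.unique ((hasDerivAt_id u).sub_const u₀)
    rw [(hLΩ u huV).2] at h3
    rwa [← eq_div_of_mul_eq (hu u huV) (by rw [mul_comm]; exact h3)]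
  set Z : ℂ → ℂ := fun u => F (L u) with hZ
  have hZd : ∀ u ∈ V, HasDerivAt Z (-(2 / n) * (a / T (L u) ^ 2) * r (L u) * (1 / (u - u₀))) u :=
    fun u huV => (hFd _ (hLΩ u huV).1).comp u (hLd u huV)
  have hZ0 : ∀ u ∈ V, Z u ≠ 0 := by
    intro u huV
    have h1 : Z u = a * m (L u) / T (L u) ^ 2 := hFx _
    rw [h1]
    exact div_ne_zero (mul_ne_zero ha0 (h _ (hLΩ u huV).1).1) (pow_ne_zero _ (hT0 _))
  have hZinv : ∀ u ∈ V, (Z u)⁻¹ = T (L u) ^ 2 / a / m (L u) := by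
    intro u huV
    have h1 : Z u = a * m (L u) / T (L u) ^ 2 := hFx _
    rw [h1, inv_div, div_div]
  have h2n : (-2 : ℂ) ^ n ≠ 0 := pow_ne_zero _ (by norm_num)
  have hr0 : ∀ x ∈ Ω, r x ≠ 0 := by
    intro x hx
    rw [hr]
    simp only [ne_eq, Complex.cpow_eq_zero_iff, not_and]
    intro h0
    exact absurd h0 (Complex.slitPlane_ne_zero (h x hx).2.1)
  refine (K.isReducedSolution_iff hζ 1 hV
    (fun u huV => (hZd u huV).differentiableAt.differentiableWithinAt) (fun u huV => ?_)
    (fun u huV => ?_)).2 ⟨fun u => J (L u) - 2 * u * Z u, fun u huV => ⟨?_, ?_⟩⟩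
  · rw [hQ _ (hZ0 u huV), hZinv u huV]
    exact mul_ne_zero (mul_ne_zero (neg_ne_zero.2 h2n) (pow_ne_zero _ (hZ0 u huV)))
      (h _ (hLΩ u huV).1).2.2.1
  · rw [(hZd u huV).deriv]
    exact mul_ne_zero (mul_ne_zero (mul_ne_zero (neg_ne_zero.2 (div_ne_zero two_ne_zero hn0))
      (div_ne_zero ha0 (pow_ne_zero _ (hT0 _)))) (hr0 _ (hLΩ u huV).1))
      (one_div_ne_zero (hu u huV))
  · have h1 := (h _ (hLΩ u huV).1).2.2.2.2.comp u (hLd u huV)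
    have h2 := ((hasDerivAt_id u).const_mul (2 : ℂ)).mul (hZd u huV)
    rw [(hZd u huV).deriv]
    refine (h1.sub h2).congr_deriv ?_
    have h3 : Z u = a * m (L u) / T (L u) ^ 2 := hFx _
    have h4 := hTn2 (L u)
    simp only [hT] at h4
    rw [h3, h4, (hLΩ u huV).2]
    have h5 := hu u huV
    have h6 := hT0 (L u)
    simp only [id]
    field_simp
    ring
  · have h1 := hZ0 u huV
    have h2 := hu u huV
    have h3 := hT0 (L u)
    have h4 := (h _ (hLΩ u huV).1).1
    have h5 : Z u = a * m (L u) / T (L u) ^ 2 := hFx _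
    have hr2 : r (L u) ^ 2 = S (L u) := by
      rw [hr]
      simp only
      rw [← Complex.cpow_nat_mul]
      norm_num
    have hTu : T (L u) ^ n = u - u₀ := by rw [hTn, (hLΩ u huV).2]
    change (K.matrixN (J (L u) - 2 * u * Z u) (Z u)).det = _
    rw [K.det_matrixN, hP _ h1, hQ _ h1, hZinv u huV, (hZd u huV).deriv]
    have hsq : (-(2 / n) * (a / T (L u) ^ 2) * r (L u) * (1 / (u - u₀))) ^ 2 =
        (2 / n) ^ 2 * (a / T (L u) ^ 2) ^ 2 * S (L u) * (1 / (u - u₀)) ^ 2 := by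
      rw [← hr2]
      ring
    have hS' := hS (L u)
    rw [scaledRHS] at hS'
    change S (L u) = m (L u) ^ (n + 2) * (1 - K.X₀.trace / 2 * (T (L u) ^ 2 / a / m (L u)) +
      P.eval (T (L u) ^ 2 / a / m (L u)) * (T (L u) ^ 2 / a / m (L u)) ^ 2 +
      (J (L u) * (T (L u) ^ 2 / a) ^ 2 / m (L u) ^ 2 - 2 * (u₀ + T (L u) ^ n) *
        (T (L u) ^ 2 / a / m (L u))) *
        (-K.φ + Q.eval (T (L u) ^ 2 / a / m (L u)) * (T (L u) ^ 2 / a / m (L u)))) at hS'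
    have hζ' : ζ = -((-2) ^ n * (n : ℂ) ^ 2 * a ^ n) / 16 := by
      rw [ha]
      ring
    rw [hsq, hS', hTu, h5, hζ', ← hTu]
    generalize P.eval (T (L u) ^ 2 / a / m (L u)) = P'
    generalize Q.eval (T (L u) ^ 2 / a / m (L u)) = Q'
    have h6 : u = T (L u) ^ n + u₀ := by rw [hTu]; ring
    generalize T (L u) = τ at *
    generalize m (L u) = m' at *
    generalize J (L u) = J' at *
    rw [h6]
    have e1 : (τ ^ n) ≠ 0 := pow_ne_zero _ h3
    have e2 : (a * m' / τ ^ 2) ^ n = a ^ n * m' ^ n / (τ ^ n) ^ 2 := by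
      rw [div_pow, mul_pow, ← pow_mul, ← pow_mul, mul_comm 2 n]
    rw [pow_add _ n 2, pow_add m' n 2, e2]
    generalize τ ^ n = w at *
    field_simp
    ring

/-- Existence of the singular solutions, with the remainder of their two-term expansion. The
parameter `σ` is `1` for `n = 2` and `0` for `n > 2`; the antiderivative `J` of
`2 a exp ((n - 2) x / n) m₀` is supplied by the two cases. -/
theorem exists_singular_solution {n : ℕ} (K : QuadricConstants n) (hn : 2 ≤ n) (hφ : K.φ ≠ 0)
    {ζ : ℂ} (hζ : ζ ≠ 0) {a : ℂ} (ha : (-2) ^ n * (n : ℂ) ^ 2 * a ^ n = -16 * ζ) (u₀ : ℂ) {σ b : ℂ}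
    (hσ : n * σ = 2 * σ) (hb : (n + 2) * b = K.X₀.trace / 2 - 2 * u₀ * K.φ) (c : ℂ)
    {Ω₀ : Set ℂ} (hΩo : IsOpen Ω₀) (hΩ : LeftInvariant Ω₀)
    (hx : (fun x : ℂ => σ * x * Complex.exp (x / n)) =O[leftEnd n Ω₀] fun _ => (1 : ℂ))
    (hv : (fun x : ℂ => Complex.exp (x / n) ^ n / (Complex.exp (x / n) ^ 2 / a) - a * σ)
      =O[leftEnd n Ω₀] fun x : ℂ => Complex.exp (x / n))
    {m₀ J : ℂ → ℂ} (hm₀ : ∀ x, m₀ x = 1 + b * (Complex.exp (x / n) ^ 2 / a) +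
      (c + a * K.φ / 3 * σ * x) * (Complex.exp (x / n) ^ 2 / a) ^ 2)
    (hJ : ∀ x, HasDerivAt J (2 * a * Complex.exp (x / n) ^ (n - 2) * m₀ x) x)
    (hJO : (fun x : ℂ => J x - 2 * a * σ * x)
      =O[leftEnd n Ω₀] fun x : ℂ => Complex.exp (x / n)) :
    ∃ R : ℝ, 0 < R ∧ ∃ m : ℂ → ℂ, ∃ C : ℝ, DifferentiableOn ℂ m (leftPart n Ω₀ R) ∧
      (∀ x ∈ leftPart n Ω₀ R, ‖m x - m₀ x‖ ≤ C * ‖Complex.exp (x / n)‖ ^ 5) ∧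
      IsMultivaluedSolution (K.IsReducedSolution ζ 1) u₀ (leftPart n Ω₀ R)
        (fun x => Complex.exp (-2 * x / n) * (a * m x)) ∧
      ∀ p : ℂ, (∀ x ∈ Ω₀, x + p ∈ Ω₀) → Complex.exp (p / n) = 1 → (∀ x, m₀ (x + p) = m₀ x) →
        (∀ x, J (x + p) = J x) → ∀ x ∈ leftPart n Ω₀ R, m (x + p) = m x := by
  have hn0 : (n : ℂ) ≠ 0 := Nat.cast_ne_zero.2 (by omega)
  have ha0 : a ≠ 0 := by
    rintro rfl
    rw [zero_pow (by omega), mul_zero] at ha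
    exact mul_ne_zero (by norm_num) hζ ha.symm
  obtain ⟨P, hP⟩ := K.exists_polynomial_E
  obtain ⟨Q, hQ⟩ := K.exists_polynomial_D
  -- the constant of integration that realizes the coefficient `c`
  set c₁ := ((n + 4) * c + n * (a * K.φ / 3 * σ) + (n + 2) * (n + 1) / 2 * b ^ 2 +
    (n + 1) * (2 * u₀ * K.φ - K.X₀.trace / 2) * b +
    (P.eval 0 - 2 * u₀ * Q.eval 0 + 2 * K.φ * a * σ)) / K.φ with hc₁
  have hc₁' : K.φ * c₁ = (n + 4) * c + n * (a * K.φ / 3 * σ) + (n + 2) * (n + 1) / 2 * b ^ 2 +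
    (n + 1) * (2 * u₀ * K.φ - K.X₀.trace / 2) * b +
    (P.eval 0 - 2 * u₀ * Q.eval 0 + 2 * K.φ * a * σ) := by
    rw [hc₁]
    field_simp
  set T : ℂ → ℂ := fun x => Complex.exp (x / n) with hTdef
  have hT : Tendsto T (leftEnd n Ω₀) (𝓝 0) := tendsto_exp_leftEnd n Ω₀
  have hTO := hT.isBigO_one ℂ
  have hJ₀O : (fun x => (c₁ + J x) - (c₁ + 2 * a * σ * x)) =O[leftEnd n Ω₀] T :=
    hJO.congr_left fun x => by ring
  have hp0 : Tendsto (fun x => T x ^ 2 / a) (leftEnd n Ω₀) (𝓝 0) := by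
    simpa using (hT.pow 2).div_const a
  set m₀' : ℂ → ℂ := fun x => 2 / n * (b * (T x ^ 2 / a)) +
    4 / n * ((c + a * K.φ / 3 * σ * x) * (T x ^ 2 / a) ^ 2) +
      a * K.φ / 3 * σ * (T x ^ 2 / a) ^ 2 with hm₀'
  have hm₀d : ∀ x, HasDerivAt m₀ (m₀' x) x := by
    intro x
    have h1 := ((hasDerivAt_exp_div n x).pow 2).div_const a
    have h2 := ((hasDerivAt_id x).const_mul (a * K.φ / 3 * σ)).const_add c
    have h3 := ((h1.const_mul b).const_add 1).add (h2.mul (h1.pow 2))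
    refine (h3.congr_deriv ?_).congr_of_eventuallyEq
      (Eventually.of_forall fun x => by rw [hm₀]; rfl)
    simp only [hm₀', hTdef, id, Pi.pow_apply]
    push_cast
    field_simp
    ring
  have hm1 : Tendsto m₀ (leftEnd n Ω₀) (𝓝 1) := by
    have h1 := (add_mul_sq_isBigO c (a * K.φ / 3) a hT hx).trans_tendsto
        (by simpa using hT.pow 3)
    have h2 := ((hp0.const_mul b).const_add 1).add h1
    simp only [mul_zero, add_zero] at h2
    exact h2.congr fun x => (hm₀ x).symm
  have hJ1 : Tendsto (fun x => (c₁ + J x) * (T x ^ 2 / a) ^ 2) (leftEnd n Ω₀) (𝓝 0) := by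
    have h1 : (fun x => (c₁ + J x) * T x) =O[leftEnd n Ω₀] fun _ => (1 : ℂ) := by
      have h2 := (hJ₀O.trans hTO).mul hTO
      simp only [mul_one] at h2
      refine ((h2.add (hTO.const_mul_left c₁)).add (hx.const_mul_left (2 * a))).congr_left
        fun x => ?_
      ring
    have h3 := h1.mul (isBigO_refl (fun x => T x ^ 3 / a ^ 2) (leftEnd n Ω₀))
    refine (h3.trans_tendsto ?_).congr fun x => ?_
    · simpa using (hT.pow 3).div_const (a ^ 2)
    · ring
  have hres := scaledField_ansatz_isBigO (by omega : n ≠ 0) P Q ha0 hσ hb (c := c) (c₁ := c₁)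
    (by linear_combination -hc₁') hT (fun x => Complex.exp_ne_zero _) hx hv hJ₀O (fun x => rfl)
    hm₀ (fun x => rfl)
  obtain ⟨R, hR, m, J', C, h, hper⟩ := exists_scaled_solution hn P Q hφ ha0 hΩo hΩ hm₀d
    (fun x => (hJ x).const_add c₁) hm1 hJ1 hres
  refine ⟨R, hR, m, C, fun x hx => (h x hx).2.2.2.2.1.differentiableAt.differentiableWithinAt,
    fun x hx => (h x hx).1, ?_, fun p h1 h2 h3 h4 => hper p h1 h2 h3 fun x => by rw [h4]⟩
  exact isMultivaluedSolution_of_scaled K hn hζ ha0 ha hP hQ (fun x => rfl)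
    fun x hx => (h x hx).2

end SingularSolutions

/-! ### Branch points -/

section BranchPoints

theorem QuadricConstants.IsReducedSolution.congr {n : ℕ} {K : QuadricConstants n} {ζ : ℂ} {k : ℕ}
    {U : Set ℂ} (hU : IsOpen U) {Z W : ℂ → ℂ} (h : K.IsReducedSolution ζ k U Z)
    (hZW : EqOn W Z U) : K.IsReducedSolution ζ k U W := by
  refine ⟨h.1.congr hZW, fun u hu => ?_⟩
  have h1 : W =ᶠ[𝓝 u] Z := by filter_upwards [hU.mem_nhds hu] with v hv using hZW hv
  rw [h1.deriv.deriv_eq, h1.deriv_eq, hZW hu]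
  exact h.2 u hu

theorem hasDerivAt_exp_div_pow (n k : ℕ) (x : ℂ) :
    HasDerivAt (fun x : ℂ => Complex.exp (x / n) ^ k) (k / n * Complex.exp (x / n) ^ k) x := by
  rcases k with _ | k
  · simpa using hasDerivAt_const x (1 : ℂ)
  · refine ((hasDerivAt_exp_div n x).pow (k + 1)).congr_deriv ?_
    push_cast
    ring

theorem exp_div_pow_isBigO (n : ℕ) (Ω₀ : Set ℂ) {k : ℕ} (hk : 1 ≤ k) :
    (fun x : ℂ => Complex.exp (x / n) ^ k) =O[leftEnd n Ω₀] fun x : ℂ => Complex.exp (x / n) := by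
  obtain ⟨j, rfl⟩ := Nat.exists_eq_add_of_le hk
  have h1 := (isBigO_refl (fun x : ℂ => Complex.exp (x / n)) (leftEnd n Ω₀)).mul
    (((tendsto_exp_leftEnd n Ω₀).isBigO_one ℂ).pow j)
  simpa [pow_add] using h1

/-- A function of `x` with period `2 π i n` that is holomorphic near the left end is a holomorphic
function of `t = exp (x / n)`; if it has a limit at the left end, the singularity `t = 0` is
removable. -/
theorem exists_differentiableOn_ball_of_periodic {n : ℕ} (hn : n ≠ 0) {R : ℝ} (hR : 0 < R)
    {m : ℂ → ℂ} {y : ℂ} (hm : DifferentiableOn ℂ m (leftPart n univ R))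
    (hper : ∀ p : ℂ, Complex.exp (p / n) = 1 → ∀ x ∈ leftPart n univ R, m (x + p) = m x)
    (hlim : Tendsto m (leftEnd n univ) (𝓝 y)) :
    ∃ H : ℂ → ℂ, DifferentiableOn ℂ H (Metric.ball 0 R) ∧ H 0 = y ∧
      (∀ x ∈ leftPart n univ R, H (Complex.exp (x / n)) = m x) := by
  have hn0 : (n : ℂ) ≠ 0 := Nat.cast_ne_zero.2 hn
  have hexp : ∀ t : ℂ, t ≠ 0 → Complex.exp (n * Complex.log t / n) = t := fun t ht => by
    rw [mul_div_cancel_left₀ _ hn0, Complex.exp_log ht]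
  set H : ℂ → ℂ := fun t => if t = 0 then y else m (n * Complex.log t) with hH
  have hHm : ∀ x ∈ leftPart n univ R, H (Complex.exp (x / n)) = m x := by
    intro x hx
    have h1 := hper (n * Complex.log (Complex.exp (x / n)) - x) ?_ x hx
    · rw [hH]
      simp only [Complex.exp_ne_zero, if_false]
      rw [← h1]
      congr 1
      ring
    · rw [sub_div, Complex.exp_sub, hexp _ (Complex.exp_ne_zero _),
        div_self (Complex.exp_ne_zero _)]
  refine ⟨H, ?_, by simp [hH], hHm⟩
  rw [← Complex.differentiableOn_compl_singleton_and_continuousAt_iff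
    (Metric.ball_mem_nhds (0 : ℂ) hR)]
  constructor
  · rintro t ⟨ht, ht0⟩
    have ht0' : t ≠ 0 := ht0
    -- a branch of the logarithm near `t`
    set ℓ : ℂ → ℂ := fun s => n * (Complex.log (s / t) + Complex.log t) with hℓ
    have hℓexp : ∀ s : ℂ, s ≠ 0 → Complex.exp (ℓ s / n) = s := by
      intro s hs
      rw [hℓ]
      simp only
      rw [mul_div_cancel_left₀ _ hn0, Complex.exp_add, Complex.exp_log (div_ne_zero hs ht0'),
        Complex.exp_log ht0', div_mul_cancel₀ _ ht0']
    have hℓmem : ∀ s ∈ Metric.ball (0 : ℂ) R, s ≠ 0 → ℓ s ∈ leftPart n univ R := by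
      intro s hs hs0
      refine ⟨mem_univ _, ?_⟩
      rw [hℓexp s hs0]
      simpa using hs
    have hℓd : DifferentiableAt ℂ ℓ t := by
      have h1 : DifferentiableAt ℂ (fun s => Complex.log (s / t)) t := by
        refine DifferentiableAt.clog (by fun_prop) ?_
        rw [div_self ht0']
        exact Complex.one_mem_slitPlane
      exact (h1.add_const _).const_mul _
    have h2 := (hm.differentiableAt ((isOpen_leftPart isOpen_univ R).mem_nhds
      (hℓmem t ht ht0'))).comp t hℓd
    refine (h2.congr_of_eventuallyEq ?_).differentiableWithinAt
    filter_upwards [Metric.isOpen_ball.mem_nhds ht, isOpen_ne.mem_nhds ht0'] with s hs hs0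
    have h3 := hHm _ (hℓmem s hs hs0)
    rw [hℓexp s hs0] at h3
    exact h3
  · rw [continuousAt_iff_punctured_nhds]
    have h0 : H 0 = y := by simp [hH]
    rw [h0]
    have h1 : Tendsto (fun t : ℂ => n * Complex.log t) (𝓝[≠] 0) (leftEnd n univ) := by
      rw [leftEnd, principal_univ, inf_top_eq, tendsto_comap_iff]
      have h2 : Tendsto (fun t : ℂ => ‖t‖) (𝓝[≠] 0) (𝓝 0) := by
        have := (continuous_norm (E := ℂ)).tendsto 0
        rw [norm_zero] at this
        exact this.mono_left nhdsWithin_le_nhds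
      refine h2.congr' ?_
      filter_upwards [self_mem_nhdsWithin] with t ht
      rw [Function.comp_apply, hexp t ht]
    refine (hlim.comp h1).congr' ?_
    filter_upwards [self_mem_nhdsWithin] with t ht
    have ht' : t ≠ 0 := ht
    simp [hH, ht']

/-- For `n > 2` the solutions with an algebraic branch point of exponent `-2 / n`. -/
theorem exists_algebraic_branch {n : ℕ} (K : QuadricConstants n) (hn : 2 < n) (hφ : K.φ ≠ 0)
    {ζ : ℂ} (hζ : ζ ≠ 0) (u₀ : ℂ) {a : ℂ} (ha : (-2) ^ n * (n : ℂ) ^ 2 * a ^ n = -16 * ζ) :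
    ∃ b : ℂ, ∀ c : ℂ, ∃ R : ℝ, 0 < R ∧ ∃ H : ℂ → ℂ,
        DifferentiableOn ℂ H (Metric.ball 0 R) ∧
        (fun t : ℂ => H t - (a + b * t ^ 2 + c * t ^ 4)) =O[𝓝 0] (fun t : ℂ => t ^ 5) ∧
        IsMultivaluedSolution (K.IsReducedSolution ζ 1) u₀
          {x : ℂ | ‖Complex.exp (x / n)‖ < R}
          (fun x : ℂ => Complex.exp (-2 * x / n) * H (Complex.exp (x / n))) := by
  have hn0 : (n : ℂ) ≠ 0 := Nat.cast_ne_zero.2 (by omega)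
  have ha0 : a ≠ 0 := by
    rintro rfl
    rw [zero_pow (by omega), mul_zero] at ha
    exact mul_ne_zero (by norm_num) hζ ha.symm
  have hn2 : ((n : ℂ) + 2) ≠ 0 := by exact_mod_cast (by omega : n + 2 ≠ 0)
  obtain ⟨k, hnk⟩ := Nat.exists_eq_add_of_le hn.le
  have hk : (k : ℂ) ≠ 0 := Nat.cast_ne_zero.2 (by omega)
  set b := (K.X₀.trace / 2 - 2 * u₀ * K.φ) / (n + 2) with hb
  refine ⟨b, fun c => ?_⟩
  set T : ℂ → ℂ := fun x => Complex.exp (x / n) with hT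
  set m₀ : ℂ → ℂ := fun x => 1 + b * (T x ^ 2 / a) +
      (a * c + a * K.φ / 3 * 0 * x) * (T x ^ 2 / a) ^ 2 with hm₀
  set J : ℂ → ℂ := fun x => 2 * a * (n / k * T x ^ k + b / a * T x ^ n +
    c / a * (n / (n + 2 : ℕ)) * T x ^ (n + 2)) with hJ
  have hJd : ∀ x, HasDerivAt J (2 * a * T x ^ (n - 2) * m₀ x) x := by
    intro x
    have h1 := (((hasDerivAt_exp_div_pow n k x).const_mul ((n : ℂ) / k)).add
      ((hasDerivAt_exp_div_pow n n x).const_mul (b / a))).add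
      ((hasDerivAt_exp_div_pow n (n + 2) x).const_mul (c / a * (n / (n + 2 : ℕ))))
    refine (h1.const_mul (2 * a)).congr_deriv ?_
    have h2 : n - 2 = k := by omega
    have h3 : T x ^ n = T x ^ 2 * T x ^ k := by rw [← pow_add, ← hnk]
    have h4 : ((n + 2 : ℕ) : ℂ) ≠ 0 := by exact_mod_cast (by omega : n + 2 ≠ 0)
    change 2 * a * (n / k * (k / n * T x ^ k) + b / a * (n / n * T x ^ n) +
      c / a * (n / (n + 2 : ℕ)) * ((n + 2 : ℕ) / n * T x ^ (n + 2))) = _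
    rw [h2, pow_add _ n 2, h3]
    simp only [hm₀]
    field_simp
    ring
  have hO : ∀ j : ℕ, 1 ≤ j → (fun x => T x ^ j) =O[leftEnd n univ] T := fun j hj =>
    exp_div_pow_isBigO n univ hj
  obtain ⟨R, hR, m, C, hmd, hmb, hsol, hper⟩ := exists_singular_solution K hn.le hφ hζ ha u₀
    (σ := 0) (b := b) (by simp) (by rw [hb]; field_simp) (a * c) isOpen_univ
    (fun x _ s _ => mem_univ _) (by simp only [zero_mul]; exact isBigO_zero _ _)
    (by
      refine ((hO k (by omega)).const_mul_left a).congr_left fun x => ?_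
      have h1 : T x ≠ 0 := Complex.exp_ne_zero _
      change a * T x ^ k = T x ^ n / (T x ^ 2 / a) - a * 0
      have h3 : T x ^ n = T x ^ 2 * T x ^ k := by rw [← pow_add, ← hnk]
      rw [h3]
      field_simp
      ring)
    (m₀ := m₀) (J := J) (fun x => rfl) hJd
    (by
      refine (((((hO k (by omega)).const_mul_left ((n : ℂ) / k)).add
        ((hO n (by omega)).const_mul_left (b / a))).add
        ((hO (n + 2) (by omega)).const_mul_left (c / a * (n / (n + 2 : ℕ))))).const_mul_left
          (2 * a)).congr_left fun x => ?_
      simp only [hJ]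
      ring)
  have hTlim : Tendsto T (leftEnd n univ) (𝓝 0) := tendsto_exp_leftEnd n univ
  have hm₀T : Tendsto m₀ (leftEnd n univ) (𝓝 1) := by
    have h1 : Tendsto (fun x => T x ^ 2 / a) (leftEnd n univ) (𝓝 0) := by
      simpa using (hTlim.pow 2).div_const a
    have h2 := ((h1.const_mul b).const_add 1).add ((h1.pow 2).const_mul (a * c))
    simpa [hm₀] using h2
  have hlim : Tendsto m (leftEnd n univ) (𝓝 1) := by
    have h1 : Tendsto (fun x => m x - m₀ x) (leftEnd n univ) (𝓝 0) := by
      refine squeeze_zero_norm' (a := fun x => C * ‖T x‖ ^ 5) ?_ ?_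
      · exact eventually_leftEnd.2 ⟨R, hR, fun x hx hxR => hmb x ⟨hx, hxR⟩⟩
      · simpa using (hTlim.norm.pow 5).const_mul C
    simpa using h1.add hm₀T
  have hTp : ∀ p : ℂ, Complex.exp (p / n) = 1 → ∀ x, T (x + p) = T x := fun p hp x => by
    rw [hT]
    simp only
    rw [add_div, Complex.exp_add, hp, mul_one]
  obtain ⟨H, hHd, hH0, hHm⟩ := exists_differentiableOn_ball_of_periodic (by omega) hR hmd
    (fun p hp x hx => hper p (fun _ _ => mem_univ _) hp
      (fun x => by simp only [hm₀, hTp p hp, mul_zero, zero_mul])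
      (fun x => by simp only [hJ, hTp p hp]) x hx) hlim
  refine ⟨R, hR, fun t => a * H t, hHd.const_mul a, ?_, ?_⟩
  · refine IsBigO.of_bound (‖a‖ * C) ?_
    filter_upwards [Metric.ball_mem_nhds (0 : ℂ) hR] with t ht
    by_cases ht0 : t = 0
    · subst ht0
      simp [hH0]
    · have h1 : Complex.exp (n * Complex.log t / n) = t := by
        rw [mul_div_cancel_left₀ _ hn0, Complex.exp_log ht0]
      have h2 : (n : ℂ) * Complex.log t ∈ leftPart n univ R :=
        ⟨mem_univ _, by rw [h1]; simpa using ht⟩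
      have h3 := hmb _ h2
      have h4 := hHm _ h2
      rw [h1] at h3 h4
      have h5 : a * H t - (a + b * t ^ 2 + c * t ^ 4) =
          a * (m (n * Complex.log t) - m₀ (n * Complex.log t)) := by
        rw [h4]
        simp only [hm₀, hT, h1]
        field_simp
        ring
      rw [h5, norm_mul, norm_pow, mul_assoc]
      exact mul_le_mul_of_nonneg_left h3 (norm_nonneg a)
  · intro V L hV hL hLΩ
    have hLΩ' : ∀ u ∈ V, L u ∈ leftPart n univ R ∧ Complex.exp (L u) = u - u₀ :=
      fun u hu => ⟨⟨mem_univ _, (hLΩ u hu).1⟩, (hLΩ u hu).2⟩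
    refine (hsol V L hV hL hLΩ').congr hV fun u hu => ?_
    simp only
    rw [hHm _ (hLΩ' u hu).1]

/-- For `n = 2` the solutions with a logarithmic branch point. -/
theorem exists_logarithmic_branch (K : QuadricConstants 2) (hφ : K.φ ≠ 0) {ζ : ℂ} (hζ : ζ ≠ 0)
    {κ : ℂ} (u₀ c : ℂ) (hκ : κ ^ 2 = -ζ) (M : ℝ) :
    ∃ r : ℝ, 0 < r ∧ ∃ F : ℂ → ℂ,
        DifferentiableOn ℂ F (logStrip r M) ∧
        (fun x : ℂ => F x - (κ * Complex.exp (-x) + (K.X₀.trace / 8 - K.φ * u₀ / 2)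
            + (c + K.φ / 3 * x) * Complex.exp x))
          =o[comap Complex.re atBot ⊓ 𝓟 (logStrip r M)] Complex.exp ∧
        IsMultivaluedSolution (K.IsReducedSolution ζ 1) u₀ (logStrip r M) F := by
  have hκ0 : κ ≠ 0 := by
    rintro rfl
    simp only [ne_eq, OfNat.ofNat_ne_zero, not_false_eq_true, zero_pow] at hκ
    exact hζ (neg_eq_zero.1 hκ.symm)
  set Ω₀ : Set ℂ := {x | |x.im| < M} with hΩ₀
  have hΩo : IsOpen Ω₀ := isOpen_lt (by fun_prop) continuous_const
  have hΩ : LeftInvariant Ω₀ := fun x hx s _ => by simpa [hΩ₀] using hx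
  set T : ℂ → ℂ := fun x => Complex.exp (x / (2 : ℕ)) with hT
  have hT2 : ∀ x, T x ^ 2 = Complex.exp x := fun x => by
    rw [hT, ← Complex.exp_nat_mul]
    congr 1
    push_cast
    ring
  have hT2n : ∀ x, ‖T x‖ ^ 2 = ‖Complex.exp x‖ := fun x => by rw [← norm_pow, hT2]
  have hTlim : Tendsto T (leftEnd 2 Ω₀) (𝓝 0) := tendsto_exp_leftEnd 2 Ω₀
  -- on the strip, |x| |exp (x / 2)| ≤ (|Re x| + M) exp (Re x / 2) ≤ 2 + M for Re x < 0
  have hx : (fun x : ℂ => 1 * x * T x) =O[leftEnd 2 Ω₀] fun _ => (1 : ℂ) := by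
    refine IsBigO.of_bound (2 + |M|) (eventually_leftEnd.2 ⟨1, one_pos, fun x hx hx1 => ?_⟩)
    rw [norm_one, mul_one, one_mul, norm_mul]
    have h1 : ‖T x‖ = Real.exp (x.re / 2) := by
      have := norm_exp_div 2 x
      simpa [hT] using this
    have h2 : ‖x‖ ≤ |x.re| + |x.im| := Complex.norm_le_abs_re_add_abs_im x
    have h3 : x.re < 0 := by
      have h4 : ‖T x‖ < 1 := hx1
      rw [h1, Real.exp_lt_one_iff] at h4
      linarith
    have h4 : |x.re| * ‖T x‖ ≤ 2 := by
      rw [h1, abs_of_neg h3]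
      have h5 := Real.add_one_le_exp (-(x.re / 2))
      have h6 : Real.exp (-(x.re / 2)) * Real.exp (x.re / 2) = 1 := by
        rw [← Real.exp_add]
        simp
      nlinarith [Real.exp_pos (x.re / 2)]
    have h5 : |x.im| * ‖T x‖ ≤ |M| := by
      have h6 : |x.im| ≤ |M| := (le_of_lt hx).trans (le_abs_self M)
      have h7 : ‖T x‖ ≤ 1 := le_of_lt hx1
      nlinarith [norm_nonneg (T x), abs_nonneg x.im]
    nlinarith [mul_le_mul_of_nonneg_right h2 (norm_nonneg (T x))]
  set b := (K.X₀.trace / 2 - 2 * u₀ * K.φ) / 4 with hb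
  set m₀ : ℂ → ℂ := fun x => 1 + b * (T x ^ 2 / κ) +
      (κ * c + κ * K.φ / 3 * 1 * x) * (T x ^ 2 / κ) ^ 2 with hm₀
  set J : ℂ → ℂ := fun x => 2 * κ * (x + b / κ * T x ^ 2 +
    (c / (2 * κ) + K.φ / (3 * κ) * (x / 2 - 1 / 4)) * T x ^ 4) with hJ
  have hJd : ∀ x, HasDerivAt J (2 * κ * T x ^ (2 - 2) * m₀ x) x := by
    intro x
    have h2 := (hasDerivAt_exp_div_pow 2 2 x).const_mul (b / κ)
    have h4 := ((((((hasDerivAt_id x).div_const 2).sub_const (1 / 4)).const_mul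
      (K.φ / (3 * κ))).const_add (c / (2 * κ))).mul (hasDerivAt_exp_div_pow 2 4 x))
    refine ((((hasDerivAt_id x).add h2).add h4).const_mul (2 * κ)).congr_deriv ?_
    simp only [hm₀, hT, id]
    push_cast
    field_simp
    ring
  have hO : ∀ j : ℕ, 1 ≤ j → (fun x => T x ^ j) =O[leftEnd 2 Ω₀] T := fun j hj =>
    exp_div_pow_isBigO 2 Ω₀ hj
  obtain ⟨R, hR, m, C, hmd, hmb, hsol, -⟩ := exists_singular_solution K le_rfl hφ hζ (a := κ)
    (by push_cast; rw [hκ]; ring) u₀ (σ := 1) (b := b) (by push_cast; ring)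
    (by rw [hb]; push_cast; ring) (κ * c) hΩo hΩ hx
    (by
      refine IsBigO.of_bound 1 (Eventually.of_forall fun x => ?_)
      have h1 : T x ≠ 0 := Complex.exp_ne_zero _
      have h2 : T x ^ 2 / (T x ^ 2 / κ) - κ * 1 = 0 := by
        field_simp
        ring
      change ‖T x ^ 2 / (T x ^ 2 / κ) - κ * 1‖ ≤ 1 * ‖T x‖
      rw [h2]
      simp)
    (m₀ := m₀) (J := J) (fun x => rfl) hJd
    (by
      have h1 := (hx.mul (isBigO_refl T (leftEnd 2 Ω₀))).const_mul_left (K.φ / (6 * κ))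
      have h2 := h1.mul ((hTlim.pow 2).isBigO_one ℂ)
      simp only [one_mul, mul_one] at h2
      refine ((((hO 2 (by norm_num)).const_mul_left (b / κ)).add
        (((hO 4 (by norm_num)).const_mul_left (c / (2 * κ) - K.φ / (12 * κ))).add
          h2)).const_mul_left (2 * κ)).congr_left fun x => ?_
      simp only [hJ]
      field_simp
      ring)
  have hstrip : logStrip (R ^ 2) M ⊆ leftPart 2 Ω₀ R := by
    rintro x ⟨h1, h2⟩
    refine ⟨h2, ?_⟩
    rw [← hT2n] at h1
    exact lt_of_pow_lt_pow_left₀ 2 hR.le h1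
  refine ⟨R ^ 2, by positivity, fun x => Complex.exp (-2 * x / (2 : ℕ)) * (κ * m x), ?_, ?_, ?_⟩
  · have h1 := hmd.mono hstrip
    fun_prop
  · have hbound : ∀ x ∈ logStrip (R ^ 2) M,
        ‖Complex.exp (-2 * x / (2 : ℕ)) * (κ * m x) - (κ * Complex.exp (-x) +
          (K.X₀.trace / 8 - K.φ * u₀ / 2) + (c + K.φ / 3 * x) * Complex.exp x)‖ ≤
        ‖κ‖ * C * ‖T x‖ * ‖Complex.exp x‖ := by
      intro x hx
      have h1 := hmb x (hstrip hx)
      have h2 : Complex.exp (-2 * x / (2 : ℕ)) = Complex.exp (-x) := by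
        congr 1
        push_cast
        ring
      have h3 : Complex.exp (-x) = (T x ^ 2)⁻¹ := by rw [hT2, Complex.exp_neg]
      have h4 : T x ≠ 0 := Complex.exp_ne_zero _
      have h5 : Complex.exp (-2 * x / (2 : ℕ)) * (κ * m x) - (κ * Complex.exp (-x) +
          (K.X₀.trace / 8 - K.φ * u₀ / 2) + (c + K.φ / 3 * x) * Complex.exp x) =
          κ * (T x ^ 2)⁻¹ * (m x - m₀ x) := by
        rw [h2, h3, ← hT2]
        simp only [hm₀, hb]
        field_simp
        ring
      rw [h5, norm_mul, norm_mul, norm_inv, norm_pow, ← hT2n x]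
      have h6 : ‖T x‖ ≠ 0 := norm_ne_zero_iff.2 h4
      refine (mul_le_mul_of_nonneg_left h1 (by positivity)).trans_eq ?_
      change ‖κ‖ * (‖T x‖ ^ 2)⁻¹ * (C * ‖T x‖ ^ 5) = _
      field_simp
    rw [isLittleO_iff]
    intro ε hε
    have hT0 : Tendsto (fun x => ‖κ‖ * C * ‖T x‖) (comap Complex.re atBot) (𝓝 0) := by
      have h1 : Tendsto (fun x : ℂ => ‖T x‖) (comap Complex.re atBot) (𝓝 0) := by
        have h2 : ∀ x : ℂ, ‖T x‖ = Real.exp (x.re / (2 : ℕ)) := norm_exp_div 2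
        simp only [h2]
        refine Real.tendsto_exp_atBot.comp ?_
        exact (tendsto_comap (f := Complex.re)).atBot_div_const (by norm_num)
      simpa using h1.const_mul (‖κ‖ * C)
    have h1 := (hT0.eventually_lt_const hε).filter_mono
      (inf_le_left : _ ⊓ 𝓟 (logStrip (R ^ 2) M) ≤ _)
    have h2 : ∀ᶠ x in comap Complex.re atBot ⊓ 𝓟 (logStrip (R ^ 2) M), x ∈ logStrip (R ^ 2) M :=
      eventually_inf_principal.2 (Eventually.of_forall fun x hx => hx)
    filter_upwards [h1, h2] with x hx hxs
    exact (hbound x hxs).trans (mul_le_mul_of_nonneg_right hx.le (norm_nonneg _))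
  · intro V L hV hL hLΩ
    exact hsol V L hV hL fun u hu => ⟨hstrip (hLΩ u hu).1, (hLΩ u hu).2⟩

end BranchPoints

/-! ### Failure of the Painlevé property -/

section PainleveProperty

/-- A multivalued solution around `0` of an equation with the Painlevé property agrees with a
meromorphic function on the positive real axis near `0`. -/
theorem HasPainleveProperty.exists_meromorphicAt {Sol : Set ℂ → (ℂ → ℂ) → Prop}
    (hP : HasPainleveProperty Sol) {Ω : Set ℂ} {F : ℂ → ℂ} (hF : IsMultivaluedSolution Sol 0 Ω F)
    {r : ℝ} (hr : 0 < r) (hΩ : ∀ x : ℂ, |x.im| < 2 → ‖Complex.exp x‖ < r → x ∈ Ω) :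
    ∃ W : ℂ → ℂ, MeromorphicAt W 0 ∧
      ∀ᶠ y : ℝ in atTop, W (Complex.exp (-y)) = F (-y) := by
  -- the disc whose boundary touches the imaginary axis at `0`
  set V : Set ℂ := Metric.ball ((r / 2 : ℝ) : ℂ) (r / 2) with hV
  have hVre : ∀ u ∈ V, 0 < u.re ∧ ‖u‖ < r := by
    intro u hu
    rw [hV, Metric.mem_ball, dist_eq_norm] at hu
    have h1 := Complex.abs_re_le_norm (u - ((r / 2 : ℝ) : ℂ))
    rw [Complex.sub_re, Complex.ofReal_re] at h1
    have h2 := neg_abs_le (u.re - r / 2)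
    have h3 := norm_add_le (u - ((r / 2 : ℝ) : ℂ)) ((r / 2 : ℝ) : ℂ)
    rw [sub_add_cancel, Complex.norm_real, Real.norm_of_nonneg (by positivity)] at h3
    constructor <;> linarith
  have hslit : ∀ u ∈ V, u ∈ Complex.slitPlane := fun u hu => Or.inl (hVre u hu).1
  have hne : ∀ u ∈ V, u ≠ 0 := fun u hu => Complex.slitPlane_ne_zero (hslit u hu)
  have hsol := hF V Complex.log Metric.isOpen_ball
    (fun u hu => (Complex.differentiableAt_log (hslit u hu)).differentiableWithinAt)
    (fun u hu => ⟨hΩ _ ?_ ?_, by rw [Complex.exp_log (hne u hu), sub_zero]⟩)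
  · obtain ⟨W, hW, hWZ⟩ := hP V _ Metric.isOpen_ball
      ((convex_ball _ _).isConnected (Metric.nonempty_ball.2 (by positivity))) hsol
    refine ⟨W, hW 0, ?_⟩
    have h1 : Tendsto (fun y : ℝ => Real.exp (-y)) atTop (𝓝 0) :=
      Real.tendsto_exp_atBot.comp tendsto_neg_atTop_atBot
    filter_upwards [h1.eventually_lt_const hr] with y hy
    have h2 : Complex.exp (-y) = ((Real.exp (-y) : ℝ) : ℂ) := by push_cast; rfl
    have h3 : Complex.exp (-y) ∈ V := by
      rw [hV, Metric.mem_ball, dist_eq_norm, h2, ← Complex.ofReal_sub, Complex.norm_real,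
        Real.norm_eq_abs, abs_lt]
      have := Real.exp_pos (-y)
      constructor <;> linarith
    have h4 := hWZ h3
    simp only at h4
    rw [← h4, h2, ← Complex.ofReal_log (Real.exp_pos _).le, Real.log_exp, Complex.ofReal_neg]
  · rw [Complex.log_im]
    have h1 := Complex.abs_arg_lt_pi_div_two_iff.2 (Or.inl (hVre u hu).1)
    have := Real.pi_lt_four
    linarith
  · rw [Complex.exp_log (hne u hu)]
    exact (hVre u hu).2

theorem tendsto_exp_neg_nhdsNE :
    Tendsto (fun y : ℝ => Complex.exp (-y)) atTop (𝓝[≠] 0) := by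
  refine tendsto_nhdsWithin_iff.2 ⟨?_, Eventually.of_forall fun y => Complex.exp_ne_zero _⟩
  rw [tendsto_zero_iff_norm_tendsto_zero]
  refine (Real.tendsto_exp_atBot.comp tendsto_neg_atTop_atBot).congr fun y => ?_
  rw [Complex.norm_exp]
  simp

theorem meromorphicOrderAt_fun_id : meromorphicOrderAt (fun u : ℂ => u) 0 = 1 :=
  meromorphicOrderAt_id

/-- A function with an algebraic branch point of exponent `-2 / n`, `n > 2`, is not meromorphic:
its order `o` would satisfy `n o = -2`. -/
theorem not_hasPainleveProperty_of_two_lt {n : ℕ} (K : QuadricConstants n) (hn : 2 < n)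
    (hφ : K.φ ≠ 0) {ζ : ℂ} (hζ : ζ ≠ 0) : ¬ HasPainleveProperty (K.IsReducedSolution ζ 1) := by
  intro hP
  have hn0 : (n : ℂ) ≠ 0 := Nat.cast_ne_zero.2 (by omega)
  have hne : (-2 : ℂ) ^ n * (n : ℂ) ^ 2 ≠ 0 :=
    mul_ne_zero (pow_ne_zero _ (by norm_num)) (pow_ne_zero _ hn0)
  obtain ⟨a, ha⟩ := IsAlgClosed.exists_pow_nat_eq (-16 * ζ / ((-2 : ℂ) ^ n * (n : ℂ) ^ 2))
    (n := n) (by omega)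
  have ha' : (-2) ^ n * (n : ℂ) ^ 2 * a ^ n = -16 * ζ := by rw [ha, mul_div_cancel₀ _ hne]
  have ha0 : a ^ n ≠ 0 := by
    rw [ha]
    exact div_ne_zero (mul_ne_zero (by norm_num) hζ) hne
  obtain ⟨b, hb⟩ := exists_algebraic_branch K hn hφ hζ 0 ha'
  obtain ⟨R, hR, H, -, hHO, hsol⟩ := hb 0
  obtain ⟨W, hW, hWF⟩ := hP.exists_meromorphicAt hsol (r := R ^ n) (by positivity)
    (fun x _ hx => by
      refine lt_of_pow_lt_pow_left₀ n hR.le ?_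
      rw [← norm_pow, ← Complex.exp_nat_mul, mul_div_cancel₀ _ hn0]
      exact hx)
  have hH : Tendsto H (𝓝 0) (𝓝 a) := by
    have h1 : Tendsto (fun t : ℂ => H t - (a + b * t ^ 2 + 0 * t ^ 4)) (𝓝 0) (𝓝 0) := by
      refine hHO.trans_tendsto ?_
      exact (by fun_prop : Continuous fun t : ℂ => t ^ 5).tendsto' 0 0 (by simp)
    have h2 : Tendsto (fun t : ℂ => a + b * t ^ 2 + 0 * t ^ 4) (𝓝 0) (𝓝 a) :=
      (by fun_prop : Continuous fun t : ℂ => a + b * t ^ 2 + 0 * t ^ 4).tendsto' 0 a (by simp)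
    simpa using h1.add h2
  have hroot : Tendsto (fun y : ℝ => Complex.exp (-y / n)) atTop (𝓝 0) := by
    rw [tendsto_zero_iff_norm_tendsto_zero]
    have h1 : Tendsto (fun y : ℝ => -y / (n : ℝ)) atTop atBot :=
      tendsto_neg_atTop_atBot.atBot_div_const (Nat.cast_pos.2 (by omega))
    refine (Real.tendsto_exp_atBot.comp h1).congr fun y => ?_
    rw [norm_exp_div]
    simp
  set g : ℂ → ℂ := fun u => W u ^ n * u ^ 2 with hg
  have hgm : MeromorphicAt g 0 := (hW.pow n).mul ((MeromorphicAt.id 0).pow 2)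
  have hlim : Tendsto (fun y : ℝ => g (Complex.exp (-y))) atTop (𝓝 (a ^ n)) := by
    refine ((hH.comp hroot).pow n).congr' ?_
    filter_upwards [hWF] with y hy
    rw [hg]
    simp only [Function.comp_apply]
    rw [hy, mul_pow, ← Complex.exp_nat_mul, ← Complex.exp_nat_mul, mul_right_comm,
      ← Complex.exp_add]
    have : (n : ℂ) * (-2 * -(y : ℂ) / n) + (2 : ℕ) * -(y : ℂ) = 0 := by
      push_cast
      field_simp
      ring
    rw [this, Complex.exp_zero, one_mul]
  have hord : meromorphicOrderAt g 0 = 0 := by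
    rcases lt_trichotomy (meromorphicOrderAt g 0) 0 with h | h | h
    · have h1 := (tendsto_cobounded_of_meromorphicOrderAt_neg h).comp tendsto_exp_neg_nhdsNE
      exact absurd hlim (h1.not_tendsto (Metric.disjoint_cobounded_nhds _))
    · exact h
    · have h1 := (tendsto_zero_of_meromorphicOrderAt_pos h).comp tendsto_exp_neg_nhdsNE
      exact absurd (tendsto_nhds_unique hlim h1) ha0
  have h1 : meromorphicOrderAt g 0 = n * meromorphicOrderAt W 0 + 2 * 1 := by
    have h2 : g = W ^ n * (fun u : ℂ => u) ^ 2 := rfl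
    have hid : MeromorphicAt (fun u : ℂ => u) 0 := MeromorphicAt.id 0
    rw [h2, meromorphicOrderAt_mul (hW.pow n) (hid.pow 2), meromorphicOrderAt_pow hW,
      meromorphicOrderAt_pow hid, meromorphicOrderAt_fun_id]
    rfl
  rw [hord] at h1
  rcases eq_or_ne (meromorphicOrderAt W 0) ⊤ with h | h
  · rw [h] at h1
    have h2 : (n : WithTop ℤ) ≠ 0 := by exact_mod_cast (by omega : n ≠ 0)
    rw [WithTop.mul_top h2, top_add] at h1
    exact absurd h1 WithTop.zero_ne_top
  · lift meromorphicOrderAt W 0 to ℤ using h with o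
    have h2 : (0 : ℤ) = n * o + 2 * 1 := by
      rw [← WithTop.coe_inj (α := ℤ), WithTop.coe_add, WithTop.coe_mul]
      exact h1
    have h3 : (n : ℤ) ∣ 2 := ⟨-o, by linarith⟩
    have h4 := Int.le_of_dvd (by norm_num) h3
    omega

/-- A function with a logarithmic branch point is not meromorphic: after subtraction of the first
terms and division by `u` it grows like `log u`, that is, it is unbounded, but its product with `u`
tends to `0`. -/
theorem not_hasPainleveProperty_two (K : QuadricConstants 2)
    (hφ : K.φ ≠ 0) {ζ : ℂ} (hζ : ζ ≠ 0) : ¬ HasPainleveProperty (K.IsReducedSolution ζ 1) := by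
  intro hP
  obtain ⟨κ, hκ⟩ := IsAlgClosed.exists_pow_nat_eq (-ζ) (n := 2) (by norm_num)
  obtain ⟨r, hr, F, -, hFo, hsol⟩ := exists_logarithmic_branch K hφ hζ 0 0 hκ 2
  obtain ⟨W, hW, hWF⟩ := hP.exists_meromorphicAt hsol hr fun x h1 h2 => ⟨h2, h1⟩
  set c₀ := K.X₀.trace / 8 - K.φ * 0 / 2 with hc₀
  set g : ℂ → ℂ := fun u => (W u - (κ * u⁻¹ + c₀)) * u⁻¹ with hg
  have hid : MeromorphicAt (fun u : ℂ => u) 0 := MeromorphicAt.id 0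
  have hgm : MeromorphicAt g 0 :=
    (hW.sub (((MeromorphicAt.const κ 0).mul hid.inv).add (MeromorphicAt.const c₀ 0))).mul hid.inv
  have hpath : Tendsto (fun y : ℝ => (-y : ℂ)) atTop
      (comap Complex.re atBot ⊓ 𝓟 (logStrip r 2)) := by
    refine tendsto_inf.2 ⟨tendsto_comap_iff.2 ?_, tendsto_principal.2 ?_⟩
    · refine tendsto_neg_atTop_atBot.congr fun y => ?_
      simp
    · have h1 : Tendsto (fun y : ℝ => Real.exp (-y)) atTop (𝓝 0) :=
        Real.tendsto_exp_atBot.comp tendsto_neg_atTop_atBot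
      filter_upwards [h1.eventually_lt_const hr] with y hy
      refine ⟨?_, by simp⟩
      rw [Complex.norm_exp]
      simpa using hy
  -- along the positive real axis, `g (u) = (φ / 3) log u + o(1)`
  have hg1 : Tendsto (fun y : ℝ => g (Complex.exp (-y)) + K.φ / 3 * y) atTop (𝓝 0) := by
    have h1 := (hFo.comp_tendsto hpath).tendsto_div_nhds_zero
    refine h1.congr' ?_
    filter_upwards [hWF] with y hy
    have h2 : Complex.exp (-y) ≠ 0 := Complex.exp_ne_zero _
    simp only [Function.comp_apply, hg, hy]
    rw [neg_neg, show Complex.exp (y : ℂ) = (Complex.exp (-y))⁻¹ by rw [Complex.exp_neg, inv_inv]]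
    field_simp
    ring
  have hlin : Tendsto (fun y : ℝ => ‖K.φ / 3 * (y : ℂ)‖) atTop atTop := by
    have h1 : Tendsto (fun y : ℝ => ‖K.φ / 3‖ * |y|) atTop atTop :=
      tendsto_abs_atTop_atTop.const_mul_atTop
        (norm_pos_iff.2 (div_ne_zero hφ (by norm_num)))
    refine h1.congr fun y => ?_
    rw [norm_mul, Complex.norm_real, Real.norm_eq_abs]
  have hginf : Tendsto (fun y : ℝ => ‖g (Complex.exp (-y))‖) atTop atTop := by
    have h1 : Tendsto (fun y : ℝ => ‖K.φ / 3 * (y : ℂ)‖ +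
        -‖g (Complex.exp (-y)) + K.φ / 3 * y‖) atTop atTop := by
      have h2 := hg1.norm.neg
      exact hlin.atTop_add h2
    refine tendsto_atTop_mono (fun y => ?_) h1
    have h2 := norm_sub_le (g (Complex.exp (-y)) + K.φ / 3 * y) (g (Complex.exp (-y)))
    rw [add_sub_cancel_left] at h2
    linarith
  have hzero : Tendsto (fun y : ℝ => g (Complex.exp (-y)) * Complex.exp (-y)) atTop (𝓝 0) := by
    have h1 : Tendsto (fun y : ℝ => Complex.exp (-y)) atTop (𝓝 0) :=
      tendsto_exp_neg_nhdsNE.mono_right nhdsWithin_le_nhds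
    have h2 : Tendsto (fun y : ℝ => (y : ℂ) * Complex.exp (-y)) atTop (𝓝 0) := by
      rw [tendsto_zero_iff_norm_tendsto_zero]
      have h3 := (Real.tendsto_pow_mul_exp_neg_atTop_nhds_zero 1).norm
      rw [norm_zero] at h3
      refine h3.congr fun y => ?_
      rw [norm_mul, norm_mul, Complex.norm_exp, Complex.norm_real, pow_one]
      simp
    have h3 := (hg1.mul h1).sub (h2.const_mul (K.φ / 3))
    simp only [mul_zero, sub_zero] at h3
    refine h3.congr fun y => ?_
    ring
  have hpos : 0 < meromorphicOrderAt (g * fun u : ℂ => u) 0 := by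
    rcases lt_trichotomy (meromorphicOrderAt (g * fun u : ℂ => u) 0) 0 with h | h | h
    · have h1 := (tendsto_cobounded_of_meromorphicOrderAt_neg h).comp tendsto_exp_neg_nhdsNE
      exact absurd hzero (h1.not_tendsto (Metric.disjoint_cobounded_nhds _))
    · obtain ⟨c, hc, h1⟩ := tendsto_ne_zero_of_meromorphicOrderAt_eq_zero (hgm.mul hid) h
      exact absurd (tendsto_nhds_unique (h1.comp tendsto_exp_neg_nhdsNE) hzero) hc
    · exact h
  have hneg : meromorphicOrderAt g 0 < 0 := by
    by_contra! h
    obtain ⟨c, hc⟩ := tendsto_nhds_of_meromorphicOrderAt_nonneg hgm h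
    exact not_tendsto_nhds_of_tendsto_atTop hginf _ (hc.comp tendsto_exp_neg_nhdsNE).norm
  rw [meromorphicOrderAt_mul hgm hid, meromorphicOrderAt_fun_id] at hpos
  lift meromorphicOrderAt g 0 to ℤ using hneg.ne_top with o
  have h1 : (0 : ℤ) < o + 1 := by exact_mod_cast hpos
  have h2 : o < 0 := by exact_mod_cast hneg
  omega

end PainleveProperty

theorem mainTheorem3 (n : ℕ) (K : QuadricConstants n) (hφ : K.φ ≠ 0) (ζ : ℂ) (hζ : ζ ≠ 0) :
    (n = 1 → IsEquivalentToPainleveII (K.IsReducedSolution ζ 1)) ∧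
    (1 < n → ¬ HasPainleveProperty (K.IsReducedSolution ζ 1)) ∧
    (2 < n → ∀ u₀ a : ℂ, (-2) ^ n * (n : ℂ) ^ 2 * a ^ n = -16 * ζ →
      ∃ b : ℂ, ∀ c : ℂ, ∃ R : ℝ, 0 < R ∧ ∃ H : ℂ → ℂ,
        DifferentiableOn ℂ H (Metric.ball 0 R) ∧
        (fun t : ℂ => H t - (a + b * t ^ 2 + c * t ^ 4)) =O[𝓝 0] (fun t : ℂ => t ^ 5) ∧
        IsMultivaluedSolution (K.IsReducedSolution ζ 1) u₀
          {x : ℂ | ‖Complex.exp (x / n)‖ < R}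
          (fun x : ℂ => Complex.exp (-2 * x / n) * H (Complex.exp (x / n)))) ∧
    (n = 2 → ∀ κ u₀ c : ℂ, κ ^ 2 = -ζ → ∀ M : ℝ, 0 < M →
      ∃ r : ℝ, 0 < r ∧ ∃ F : ℂ → ℂ,
        DifferentiableOn ℂ F (logStrip r M) ∧
        (fun x : ℂ => F x - (κ * Complex.exp (-x) + (K.X₀.trace / 8 - K.φ * u₀ / 2)
            + (c + K.φ / 3 * x) * Complex.exp x))
          =o[comap Complex.re atBot ⊓ 𝓟 (logStrip r M)] Complex.exp ∧
        IsMultivaluedSolution (K.IsReducedSolution ζ 1) u₀ (logStrip r M) F) := by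
  refine ⟨?_, fun hn => ?_, fun hn u₀ a ha => exists_algebraic_branch K hn hφ hζ u₀ ha, ?_⟩
  · rintro rfl
    exact isEquivalentToPainleveII_of_one K hφ hζ
  · rcases (Nat.succ_le_of_lt hn).eq_or_lt with h | h
    · obtain rfl : 2 = n := h
      exact not_hasPainleveProperty_two K hφ hζ
    · exact not_hasPainleveProperty_of_two_lt K h hφ hζ
  · rintro rfl κ u₀ c hκ M -
    exact exists_logarithmic_branch K hφ hζ u₀ c hκ M
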